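/- Let $(\mathcal G_t)_{t\ge 0}$ be a deterministic family of finite multigraphs (self-loops allowed) without vertices of degree zero, given by symmetric edge multiplicities $\tilde n_{i,j}\in\{0,1,2,\dots\}$. Let $N_t$ be the number of vertices of $\mathcal G_t$, $D_{t,i}=\sum_j\tilde n_{i,j}\ge 1$ the degree of vertex $i$, $D_t^*=\sum_i D_{t,i}$, and $N_{t,j}$ the number of vertices of degree $j$. For $\phi=(\sigma,\tau,s)\in(-\infty,1)\times(0,\infty)^2$ consider the likelihood of the generalized gamma process (Caron--Fox) multigraph model, $$e^{L_t(\phi)}\ \propto\ s^{N_t}\prod_{i=1}^{N_t}\frac{\Gamma(D_{t,i}-\sigma)}{\Gamma(1-\sigma)}\int_0^\infty\!\int_{[0,\infty)} e^{-(x+y)^2}\,\frac{x^{D_t^*-\sigma N_t-1}e^{-\tau x}}{\Gamma(D_t^*-\sigma N_t)}\,G_{\sigma,\tau,s}(dy)\,dx ,$$ where $G_{\sigma,\tau,s}$ is the exponentially tilted stable distribution, i.e. the probability measure on $[0,\infty)$ with $\int e^{-\xi y}G_{\sigma,\tau,s}(dy)=e^{-s\psi(\sigma,\tau;\xi+\tau)}$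 for $\xi\ge0$, with $\psi(\sigma,\tau;\xi)=(\xi^\sigma-\tau^\sigma)/\sigma$ if $\sigma\neq0$ and $\psi(0,\tau;\xi)=\log(\xi/\tau)$. For a prior probability measure $\Pi$ on $\phi$, let $\Pi(A\mid\mathcal G_t)=\int_A e^{L_t}d\Pi\big/\int e^{L_t}d\Pi$ be the posterior. Assume that the graphs are dense: for every $c>0$, as $t\to\infty$, $$\frac{D_t^*}{N_t^{2-c}}\to+\infty,\qquad \frac{D_t^*}{N_t^{2+c}}\to 0,$$ and that there is $c_1>0$ with $$\liminf_{t\to\infty}\frac{\sum_{j\ge2}N_{t,j}\log j}{N_t\log D_t^*}\ge c_1 .$$ Assume that under the (proper, fixed) prior $\Pi$ the parameters $\sigma,\tau,s$ are independent, that $\Pi(0<\sigma<\delta)>0$ for every $\delta>0$ (for instance, $\sigma$ has a positive continuous density on $(-\infty,1)$), that $\tau$ has a Lebesgue density $\pi_\tau$, and that there are constants $\kappa,c_2,c_3,c_4>0$ such that, with $s_{*,t}=\kappa\sqrt{2D_t^*}$, for all $t$ large enough, all $(D_t^*)^{-c_3}\le x\le 1$ and all $0<\tau<1$, $$\Pi\Big(\Big|\frac{s}{s_{*,t}}-x\Big|\le\frac{1}{N_t(\log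 D_t^*)^2}\Big)\ge e^{-c_2N_t},\qquad \pi_\tau(\tau)\ge e^{-c_4/\tau^{c_4}} .$$ Then, for all $t$ large enough, the normalizing constant $\int e^{L_t}d\Pi$ is positive and finite, and for every $\varepsilon>0$, $$\Pi(\sigma>\varepsilon\mid\mathcal G_t)\ \longrightarrow\ 0\qquad(t\to\infty).$$ -/

import Mathlib

open MeasureTheory Filter Topology Set
open scoped ENNReal NNReal

/-- A finite multigraph on a vertex set of natural numbers, given by the symmetric array of edge
multiplicities (self-loops allowed), without vertices of degree zero. Only the values of `mult`
on the vertex set matter. -/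
structure FiniteMultigraph where
  verts : Finset ℕ
  mult : ℕ → ℕ → ℕ
  mult_symm : ∀ i j, mult i j = mult j i
  deg_pos : ∀ i ∈ verts, 1 ≤ ∑ j ∈ verts, mult i j

namespace FiniteMultigraph

/-- The degree `D_i` of the node `i`. -/
def deg (G : FiniteMultigraph) (i : ℕ) : ℕ := ∑ j ∈ G.verts, G.mult i j

/-- The number `N` of nodes. -/
def numVerts (G : FiniteMultigraph) : ℕ := G.verts.card

/-- The sum `D*` of all degrees. -/
def totalDeg (G : FiniteMultigraph) : ℕ := ∑ i ∈ G.verts, G.deg i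

/-- The number `N_j` of nodes of degree `j`. -/
def numDeg (G : FiniteMultigraph) (j : ℕ) : ℕ := (G.verts.filter fun i => G.deg i = j).card

/-- The sum over `j ≥ 2` of `N_j log j`; no degree exceeds `D*`, so the sum is stopped there. -/
noncomputable def sumLogDeg (G : FiniteMultigraph) : ℝ :=
  ∑ j ∈ Finset.Icc 2 G.totalDeg, (G.numDeg j : ℝ) * Real.log j

end FiniteMultigraph

namespace GGPModel

/-- The Laplace exponent: `(ξ^σ - τ^σ) / σ`, and `log (ξ / τ)` for `σ = 0`. -/
noncomputable def laplaceExponent (σ τ ξ : ℝ) : ℝ :=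
  if σ = 0 then Real.log (ξ / τ) else (ξ ^ σ - τ ^ σ) / σ

/-- `μ` is the exponentially tilted stable distribution with parameters `(σ, τ, s)`: the
probability measure on `[0, ∞)` with Laplace transform `ξ ↦ exp (- s ψ(σ, τ; ξ + τ))`. -/
def IsTiltedStable (σ τ s : ℝ) (μ : Measure ℝ) : Prop :=
  IsProbabilityMeasure μ ∧ μ (Iio 0) = 0 ∧
    ∀ ξ : ℝ, 0 ≤ ξ →
      ∫⁻ x, ENNReal.ofReal (Real.exp (-(ξ * x))) ∂μ
        = ENNReal.ofReal (Real.exp (-(s * laplaceExponent σ τ (ξ + τ))))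

open Classical in
/-- The exponentially tilted stable distribution. It exists, and is unique, for all `σ < 1`,
`τ > 0` and `s > 0`; the value for other parameters plays no role. -/
noncomputable def tiltedStable (σ τ s : ℝ) : Measure ℝ :=
  if h : ∃ μ : Measure ℝ, IsTiltedStable σ τ s μ then h.choose else 0

/-- The likelihood of the parameter `φ = (σ, τ, s)` for the observed multigraph `G`, up to a factor
that does not depend on `φ`. -/
noncomputable def likelihood (G : FiniteMultigraph) (φ : ℝ × ℝ × ℝ) : ℝ≥0∞ :=
  let σ := φ.1
  let τ := φ.2.1
  let s := φ.2.2
  let p : ℝ := (G.totalDeg : ℝ) - σ * (G.numVerts : ℝ)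
  ENNReal.ofReal (s ^ G.numVerts *
      ∏ i ∈ G.verts, (Real.Gamma ((G.deg i : ℝ) - σ) / Real.Gamma (1 - σ))) *
    ∫⁻ x in Ioi (0 : ℝ), ∫⁻ y,
      ENNReal.ofReal
        (Real.exp (-(x + y) ^ 2) * (x ^ (p - 1) * Real.exp (-(τ * x)) / Real.Gamma p))
      ∂(tiltedStable σ τ s)

/-- The normalizing constant of the posterior distribution for the prior `Q` on `(σ, τ, s)`. -/
noncomputable def evidence (Q : Measure (ℝ × ℝ × ℝ)) (G : FiniteMultigraph) : ℝ≥0∞ :=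
  ∫⁻ φ, likelihood G φ ∂Q

/-- The posterior probability of the set `A` of parameters given `G`, for the prior `Q`
(Bayes' formula). -/
noncomputable def posterior (Q : Measure (ℝ × ℝ × ℝ)) (G : FiniteMultigraph)
    (A : Set (ℝ × ℝ × ℝ)) : ℝ≥0∞ :=
  (∫⁻ φ in A, likelihood G φ ∂Q) / evidence Q G

end GGPModel

/-!
Write `N` for the number of vertices, `D` for the total degree and `P(σ)` for the product
`∏ Γ(D_i - σ) / Γ(1 - σ)` over the vertices. All estimates compare the likelihood with the baseline
`exp (D / 2) (2 D) ^ (-D / 2) N ^ N ∏ Γ(D_i)`, and only factors of size `exp (const * N log D)`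
matter.

*Values `σ > ε`.* For every `c > 0` one has `exp (-(x + y)²) ≤ exp (c²) exp (-2 c (x + y))`. With
this majorant both integrals in the likelihood are explicit, and it is at most
`exp (c²) s ^ N exp (-s ψ(τ + 2 c)) (τ + 2 c) ^ (σ N - D) P(σ)` (`likelihood_le`). Maximize over
`s`, use `ψ(τ + 2 c) ≥ 2 c (τ + 2 c) ^ (σ - 1)`, and take `c = √(D / 2)`: what remains is
`exp (D / 2) (2 D) ^ (-D / 2) N ^ N P(σ)`, for all `τ` and `s`. As `P(σ) ≤ ∏ Γ(D_i) D_i ^ (-σ)`, the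
assumption on `∑ N_j log j` makes the likelihood smaller than the baseline by a factor
`exp (-ε c₁ N log D)` (`likelihood_le_baseline`).

*The evidence.* It is at least the baseline times `exp (-γ N log D)`, for each fixed `γ > 0`
(`eventually_baseline_le_evidence`). To see this, restrict the prior to `0 < σ < δ` with `δ` fixed
and small, to `τ` of order `D ^ (-a)`, and to `s` near `κ √(2 D) D ^ (-η)`, a set of prior mass
`exp (-O(N))`; since `N = D ^ (1 / 2 + o(1))`, there `s ψ ≤ N` and
`s ^ N ≥ N ^ N exp (-2 η N log D)`. It then suffices to integrate `x` over a window of length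
`D ^ (-1 / 2)` at `√(D / 2)`, and the factor `exp (-y²)` costs only `exp (-O(N))`, because values of `y` above `(N + 1) / (2 x)`, which is
of order `N / √D`, contribute little to the Laplace transform at `2 x` (`baseline_le_likelihood`).

*Existence of the tilted stable distribution.* The lower bound needs the distribution to exist. By
the Lévy–Khintchine formula `lintegral_levy`, its Laplace exponent comes from a Lévy measure, and
`exists_laplace_eq` constructs the law as that of a countable sum of independent compound Poisson
variables.

*Finiteness.* With `c = 1` in the first estimate and the Lévy–Khintchine formula, every vertex
contributes at most `D_i!`, so that the likelihood is bounded in all parameters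
(`likelihood_le_const`).
-/

/-! ### Ratios of Gamma functions -/

lemma Gamma_add_one_sub_div_eq_mul {σ : ℝ} (hσ : σ < 1) (m : ℕ) :
    Real.Gamma (((m + 1 + 1 : ℕ) : ℝ) - σ) / Real.Gamma (1 - σ) =
      (m + 1 - σ) * (Real.Gamma (((m + 1 : ℕ) : ℝ) - σ) / Real.Gamma (1 - σ)) := by
  have hm : (0 : ℝ) ≤ m := m.cast_nonneg
  have h : ((m + 1 + 1 : ℕ) : ℝ) - σ = (((m + 1 : ℕ) : ℝ) - σ) + 1 := by push_cast; ring
  rw [h, Real.Gamma_add_one (by push_cast; linarith)]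
  push_cast
  ring

/-- `Γ(n - σ) / Γ(1 - σ)` is the product of `k - σ` over `1 ≤ k < n`, and `1 - σ / k` is at most
`exp (-σ / k)`. -/
lemma Gamma_sub_div_le {σ : ℝ} (h0 : 0 ≤ σ) (h1 : σ < 1) {n : ℕ} (hn : 1 ≤ n) :
    Real.Gamma ((n : ℝ) - σ) / Real.Gamma (1 - σ) ≤
      Real.Gamma n * Real.exp (-(σ * Real.log n)) := by
  induction n, hn using Nat.le_induction with
  | base =>
    have : Real.Gamma (1 - σ) ≠ 0 := (Real.Gamma_pos_of_pos (by linarith)).ne'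
    simp [this]
  | succ n hn ih =>
    obtain ⟨m, rfl⟩ : ∃ m, n = m + 1 := ⟨n - 1, by omega⟩
    rw [Gamma_add_one_sub_div_eq_mul h1]
    have hm : (0 : ℝ) ≤ m := m.cast_nonneg
    have hG : 0 < Real.Gamma ((m + 1 : ℕ) : ℝ) := Real.Gamma_pos_of_pos (by positivity)
    have hlog : Real.log ((m + 1 + 1 : ℕ) : ℝ) ≤ Real.log ((m + 1 : ℕ) : ℝ) + 1 / (m + 1) := by
      have h := Real.log_le_sub_one_of_pos (x := ((m : ℝ) + 2) / (m + 1)) (by positivity)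
      rw [Real.log_div (by positivity) (by positivity)] at h
      have h2 : ((m : ℝ) + 2) / (m + 1) - 1 = 1 / (m + 1) := by field_simp; ring
      push_cast
      rw [show (m : ℝ) + 1 + 1 = m + 2 by ring]
      linarith
    have hexp : (1 - σ / (m + 1)) * Real.exp (-(σ * Real.log ((m + 1 : ℕ) : ℝ))) ≤
        Real.exp (-(σ * Real.log ((m + 1 + 1 : ℕ) : ℝ))) := by
      have h := Real.add_one_le_exp (-(σ / (m + 1)))
      calc _ ≤ Real.exp (-(σ / (m + 1))) * Real.exp (-(σ * Real.log ((m + 1 : ℕ) : ℝ))) := by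
            gcongr; linarith
        _ = Real.exp (-(σ * (Real.log ((m + 1 : ℕ) : ℝ) + 1 / (m + 1)))) := by
            rw [← Real.exp_add]; congr 1; ring
        _ ≤ _ := by gcongr
    calc _ ≤ (m + 1 - σ) * (Real.Gamma ((m + 1 : ℕ) : ℝ) *
            Real.exp (-(σ * Real.log ((m + 1 : ℕ) : ℝ)))) := by
          gcongr; linarith
      _ = (m + 1) * Real.Gamma ((m + 1 : ℕ) : ℝ) *
            ((1 - σ / (m + 1)) * Real.exp (-(σ * Real.log ((m + 1 : ℕ) : ℝ)))) := by
          field_simp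
      _ ≤ (m + 1) * Real.Gamma ((m + 1 : ℕ) : ℝ) *
            Real.exp (-(σ * Real.log ((m + 1 + 1 : ℕ) : ℝ))) := by gcongr
      _ = _ := by
          have h : ((m + 1 + 1 : ℕ) : ℝ) = ((m + 1 : ℕ) : ℝ) + 1 := by push_cast; ring
          rw [h, Real.Gamma_add_one (by positivity)]; push_cast; ring

/-- A matching lower bound for `Γ(n - σ) / Γ(1 - σ)`, with a constant in the exponent that is not
sharp. -/
lemma le_Gamma_sub_div {σ : ℝ} (h0 : 0 ≤ σ) (h1 : σ ≤ 1 / 2) {n : ℕ} (hn : 1 ≤ n) :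
    Real.Gamma n * Real.exp (-(4 * σ * Real.log n)) ≤
      Real.Gamma ((n : ℝ) - σ) / Real.Gamma (1 - σ) := by
  induction n, hn using Nat.le_induction with
  | base =>
    have : Real.Gamma (1 - σ) ≠ 0 := (Real.Gamma_pos_of_pos (by linarith)).ne'
    simp [this]
  | succ n hn ih =>
    obtain ⟨m, rfl⟩ : ∃ m, n = m + 1 := ⟨n - 1, by omega⟩
    rw [Gamma_add_one_sub_div_eq_mul (by linarith)]
    have hm : (0 : ℝ) ≤ m := m.cast_nonneg
    have hG : 0 < Real.Gamma ((m + 1 : ℕ) : ℝ) := Real.Gamma_pos_of_pos (by positivity)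
    have hlog : Real.log ((m + 1 : ℕ) : ℝ) + 1 / (m + 2) ≤ Real.log ((m + 1 + 1 : ℕ) : ℝ) := by
      have h := Real.log_le_sub_one_of_pos (x := ((m : ℝ) + 1) / (m + 2)) (by positivity)
      rw [Real.log_div (by positivity) (by positivity)] at h
      have h2 : ((m : ℝ) + 1) / (m + 2) - 1 = -(1 / (m + 2)) := by field_simp; ring
      push_cast
      rw [show (m : ℝ) + 1 + 1 = m + 2 by ring]
      linarith
    set v : ℝ := σ / (m + 1) with hv
    have hv0 : 0 ≤ v := by positivity
    have hv1 : v ≤ 1 / 2 := by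
      rw [hv, div_le_iff₀ (by positivity)]; nlinarith
    have hve : Real.exp (-(2 * v)) ≤ 1 - v := by
      have h := Real.add_one_le_exp (2 * v)
      rw [Real.exp_neg, inv_le_comm₀ (Real.exp_pos _) (by linarith)]
      refine le_trans ?_ h
      rw [inv_le_iff_one_le_mul₀ (by linarith)]
      nlinarith
    have hv2 : 2 * v ≤ 4 * σ * (1 / (m + 2)) := by
      rw [hv, show 4 * σ * (1 / ((m : ℝ) + 2)) = 4 * σ / (m + 2) by ring, mul_div_assoc',
        div_le_div_iff₀ (by positivity) (by positivity)]
      nlinarith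
    have hexp : Real.exp (-(4 * σ * Real.log ((m + 1 + 1 : ℕ) : ℝ))) ≤
        (1 - v) * Real.exp (-(4 * σ * Real.log ((m + 1 : ℕ) : ℝ))) := by
      calc _ ≤ Real.exp (-(4 * σ * (Real.log ((m + 1 : ℕ) : ℝ) + 1 / (m + 2)))) := by gcongr
        _ = Real.exp (-(4 * σ * (1 / (m + 2)))) *
              Real.exp (-(4 * σ * Real.log ((m + 1 : ℕ) : ℝ))) := by
            rw [← Real.exp_add]; congr 1; ring
        _ ≤ _ := by
            gcongr
            exact le_trans (Real.exp_le_exp.2 (by linarith)) hve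
    calc _ = (m + 1) * Real.Gamma ((m + 1 : ℕ) : ℝ) *
            Real.exp (-(4 * σ * Real.log ((m + 1 + 1 : ℕ) : ℝ))) := by
          have h : ((m + 1 + 1 : ℕ) : ℝ) = ((m + 1 : ℕ) : ℝ) + 1 := by push_cast; ring
          rw [h, Real.Gamma_add_one (by positivity)]; push_cast; ring
      _ ≤ (m + 1) * Real.Gamma ((m + 1 : ℕ) : ℝ) *
            ((1 - v) * Real.exp (-(4 * σ * Real.log ((m + 1 : ℕ) : ℝ)))) := by gcongr
      _ = (m + 1 - σ) * (Real.Gamma ((m + 1 : ℕ) : ℝ) *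
            Real.exp (-(4 * σ * Real.log ((m + 1 : ℕ) : ℝ)))) := by
          rw [hv]; field_simp
      _ ≤ _ := by gcongr; linarith

/-- A crude form of Stirling's upper bound. -/
lemma Gamma_le_exp_one_mul_rpow {z : ℝ} (hz : 1 ≤ z) :
    Real.Gamma z ≤ Real.exp 1 * z ^ z * Real.exp (-z) := by
  have hz0 : 0 < z := by linarith
  have hint : IntegrableOn (fun t : ℝ => Real.exp (-(1 / z * t))) (Ioi 0) := by
    simpa using exp_neg_integrableOn_Ioi 0 (b := 1 / z) (by positivity)
  have hval : ∫ t : ℝ in Ioi 0, Real.exp (-(1 / z * t)) = z := by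
    have h := Real.integral_rpow_mul_exp_neg_mul_Ioi (a := 1) (r := 1 / z) one_pos (by positivity)
    simpa using h
  -- `t / z ≤ exp (t / z - 1)` turns the Gamma integral into that of `exp (-t / z)`
  calc Real.Gamma z = ∫ t in Ioi 0, Real.exp (-t) * t ^ (z - 1) := Real.Gamma_eq_integral hz0
    _ ≤ ∫ t in Ioi 0, z ^ (z - 1) * Real.exp (1 - z) * Real.exp (-(1 / z * t)) := by
        refine setIntegral_mono_on (Real.GammaIntegral_convergent hz0) (hint.const_mul _)
          measurableSet_Ioi fun t ht => ?_
        have ht : 0 < t := ht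
        have h1 : t / z ≤ Real.exp (t / z - 1) := by
          have := Real.add_one_le_exp (t / z - 1); linarith
        have h2 : t ^ (z - 1) ≤ z ^ (z - 1) * Real.exp ((t / z - 1) * (z - 1)) := by
          calc t ^ (z - 1) = z ^ (z - 1) * (t / z) ^ (z - 1) := by
                rw [← Real.mul_rpow hz0.le (by positivity)]; congr 1; field_simp
            _ ≤ z ^ (z - 1) * Real.exp (t / z - 1) ^ (z - 1) := by
                gcongr
            _ = _ := by rw [Real.exp_mul]
        calc _ ≤ Real.exp (-t) * (z ^ (z - 1) * Real.exp ((t / z - 1) * (z - 1))) := by gcongr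
          _ = z ^ (z - 1) * (Real.exp (-t) * Real.exp ((t / z - 1) * (z - 1))) := by ring
          _ = z ^ (z - 1) * (Real.exp (1 - z) * Real.exp (-(1 / z * t))) := by
              rw [← Real.exp_add, ← Real.exp_add]; congr 2; field_simp; ring
          _ = _ := by ring
    _ = z ^ (z - 1) * Real.exp (1 - z) * z := by rw [integral_const_mul, hval]
    _ = _ := by
        rw [Real.rpow_sub_one hz0.ne', sub_eq_add_neg, Real.exp_add]; field_simp

lemma pow_mul_exp_neg_le {u : ℝ} (hu : 0 ≤ u) (n : ℕ) : u ^ n * Real.exp (-u) ≤ (n : ℝ) ^ n := by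
  rcases Nat.eq_zero_or_pos n with rfl | hn
  · simpa using hu
  have hn' : (0 : ℝ) < n := by exact_mod_cast hn
  have h : u / n ≤ Real.exp (u / n) := by have := Real.add_one_le_exp (u / n); linarith
  have h2 : u ^ n ≤ (n : ℝ) ^ n * Real.exp u := by
    calc u ^ n = (n : ℝ) ^ n * (u / n) ^ n := by rw [← mul_pow]; congr 1; field_simp
      _ ≤ (n : ℝ) ^ n * Real.exp (u / n) ^ n := by gcongr
      _ = _ := by rw [← Real.exp_nat_mul]; congr 2; field_simp
  rw [Real.exp_neg, ← div_eq_mul_inv, div_le_iff₀ (Real.exp_pos _)]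
  exact h2

/-! ### The Laplace exponent -/

namespace GGPModel

lemma le_laplaceExponent {σ τ ξ : ℝ} (h0 : 0 < σ) (h1 : σ < 1) (hτ : 0 < τ) (hξ : τ ≤ ξ) :
    (ξ - τ) * ξ ^ (σ - 1) ≤ laplaceExponent σ τ ξ := by
  have hξ0 : 0 < ξ := by linarith
  rw [laplaceExponent, if_neg h0.ne', le_div_iff₀ h0]
  have hb := rpow_one_add_le_one_add_mul_self (s := τ / ξ - 1)
    (by have : 0 < τ / ξ := by positivity
        linarith) h0.le h1.le
  have h2 : τ ^ σ = ξ ^ σ * (1 + (τ / ξ - 1)) ^ σ := by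
    rw [add_sub_cancel, ← Real.mul_rpow hξ0.le (by positivity)]; congr 1; field_simp
  have h3 : (0 : ℝ) < ξ ^ σ := by positivity
  rw [h2, Real.rpow_sub_one hξ0.ne']
  calc (ξ - τ) * (ξ ^ σ / ξ) * σ = ξ ^ σ - ξ ^ σ * (1 + σ * (τ / ξ - 1)) := by field_simp; ring
    _ ≤ _ := by gcongr

lemma laplaceExponent_le {σ τ ξ : ℝ} (h0 : 0 < σ) (hτ : 0 < τ) (hξ : 0 < ξ) :
    laplaceExponent σ τ ξ ≤ ξ ^ σ * Real.log (ξ / τ) := by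
  rw [laplaceExponent, if_neg h0.ne', div_le_iff₀ h0]
  have h2 : τ ^ σ = ξ ^ σ * Real.exp (-(σ * Real.log (ξ / τ))) := by
    rw [show -(σ * Real.log (ξ / τ)) = Real.log (τ / ξ) * σ by
      rw [← inv_div, Real.log_inv]; ring, ← Real.rpow_def_of_pos (by positivity),
      ← Real.mul_rpow hξ.le (by positivity)]
    congr 1; field_simp
  have h3 := Real.add_one_le_exp (-(σ * Real.log (ξ / τ)))
  have h4 : (0 : ℝ) < ξ ^ σ := by positivity
  rw [h2]
  nlinarith

/-- The Laplace exponent is the integral of `u ^ (σ - 1)` over `[τ, ξ]`. -/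
lemma laplaceExponent_eq_integral {σ τ ξ : ℝ} (hτ : 0 < τ) (hξ : τ ≤ ξ) :
    laplaceExponent σ τ ξ = ∫ u in τ..ξ, u ^ (σ - 1) := by
  have h0 : (0 : ℝ) ∉ uIcc τ ξ := by
    rw [uIcc_of_le hξ]; exact fun h => absurd h.1 (not_le.2 hτ)
  rw [laplaceExponent]
  split_ifs with h
  · subst h
    simp_rw [zero_sub, Real.rpow_neg_one]
    rw [integral_inv h0]
  · rw [integral_rpow (Or.inr ⟨by intro h'; apply h; linarith, h0⟩), sub_add_cancel]

end GGPModel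

/-! ### The Lévy measure -/

lemma lintegral_rpow_mul_exp_neg_mul_Ioi {a r : ℝ} (ha : 0 < a) (hr : 0 < r) :
    ∫⁻ t in Ioi (0 : ℝ), ENNReal.ofReal (t ^ (a - 1) * Real.exp (-(r * t))) =
      ENNReal.ofReal ((1 / r) ^ a * Real.Gamma a) := by
  have h := Real.integral_rpow_mul_exp_neg_mul_Ioi ha hr
  have hpos : 0 < (1 / r) ^ a * Real.Gamma a := mul_pos (by positivity) (Real.Gamma_pos_of_pos ha)
  have hint : IntegrableOn (fun t : ℝ => t ^ (a - 1) * Real.exp (-(r * t))) (Ioi 0) := by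
    by_contra hc
    rw [integral_undef hc] at h
    linarith
  rw [← h, ofReal_integral_eq_lintegral_ofReal hint]
  filter_upwards [ae_restrict_mem measurableSet_Ioi] with t ht
  have ht : 0 < t := ht
  positivity

namespace GGPModel

/-- The Lévy–Khintchine representation of the Laplace exponent. -/
lemma lintegral_levy {σ τ ξ : ℝ} (hσ : σ < 1) (hτ : 0 < τ) (hξ : 0 ≤ ξ) :
    ∫⁻ w in Ioi (0 : ℝ),
        ENNReal.ofReal ((1 - Real.exp (-(ξ * w))) * (Real.exp (-(τ * w)) * w ^ (-1 - σ))) =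
      ENNReal.ofReal (Real.Gamma (1 - σ) * laplaceExponent σ τ (ξ + τ)) := by
  have hle : τ ≤ ξ + τ := by linarith
  have hG : 0 < Real.Gamma (1 - σ) := Real.Gamma_pos_of_pos (by linarith)
  have h1 : ∀ w ∈ Ioi (0 : ℝ),
      ENNReal.ofReal ((1 - Real.exp (-(ξ * w))) * (Real.exp (-(τ * w)) * w ^ (-1 - σ))) =
        ∫⁻ u in Ioc τ (ξ + τ), ENNReal.ofReal (w ^ (1 - σ - 1) * Real.exp (-(u * w))) := by
    intro w hw
    have hw : 0 < w := hw
    have hcont : Continuous fun u : ℝ => w ^ (1 - σ - 1) * Real.exp (-(u * w)) := by fun_prop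
    rw [← ofReal_integral_eq_lintegral_ofReal (hcont.integrableOn_Ioc)
      (Eventually.of_forall fun u => by positivity), ← intervalIntegral.integral_of_le hle]
    congr 1
    have hd : ∀ u ∈ uIcc τ (ξ + τ), HasDerivAt
        (fun u : ℝ => -(w ^ (1 - σ - 1) / w * Real.exp (-(u * w))))
        (w ^ (1 - σ - 1) * Real.exp (-(u * w))) u := by
      intro u _
      have h := (((hasDerivAt_id' u).mul_const w).fun_neg.exp.const_mul
        (w ^ (1 - σ - 1) / w)).fun_neg
      refine h.congr_deriv ?_
      field_simp
    rw [intervalIntegral.integral_eq_sub_of_hasDerivAt hd (hcont.intervalIntegrable _ _)]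
    have e1 : w ^ (1 - σ - 1) / w = w ^ (-1 - σ) := by
      rw [← Real.rpow_sub_one hw.ne']; congr 1; ring
    have e2 : Real.exp (-((ξ + τ) * w)) = Real.exp (-(ξ * w)) * Real.exp (-(τ * w)) := by
      rw [← Real.exp_add]; congr 1; ring
    rw [e1, e2]
    ring
  rw [setLIntegral_congr_fun measurableSet_Ioi h1,
    lintegral_lintegral_swap (by fun_prop)]
  have h2 : ∀ u ∈ Ioc τ (ξ + τ),
      ∫⁻ w in Ioi (0 : ℝ), ENNReal.ofReal (w ^ (1 - σ - 1) * Real.exp (-(u * w))) =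
        ENNReal.ofReal (Real.Gamma (1 - σ) * u ^ (σ - 1)) := by
    intro u hu
    have hu0 : 0 < u := hτ.trans hu.1
    rw [lintegral_rpow_mul_exp_neg_mul_Ioi (by linarith) hu0, mul_comm, one_div,
      Real.inv_rpow hu0.le, ← Real.rpow_neg hu0.le, neg_sub]
  rw [setLIntegral_congr_fun measurableSet_Ioc h2, laplaceExponent_eq_integral hτ hle,
    ← intervalIntegral.integral_const_mul, intervalIntegral.integral_of_le hle,
    ofReal_integral_eq_lintegral_ofReal]
  · refine (ContinuousOn.integrableOn_Icc ?_).mono_set Ioc_subset_Icc_self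
    refine continuousOn_const.mul (continuousOn_id.rpow_const fun u hu => Or.inl ?_)
    exact (hτ.trans_le hu.1).ne'
  · filter_upwards [ae_restrict_mem measurableSet_Ioc] with u hu
    have hu0 : 0 < u := hτ.trans hu.1
    positivity

lemma laplaceExponent_nonneg {σ τ ξ : ℝ} (hτ : 0 < τ) (hξ : τ ≤ ξ) :
    0 ≤ laplaceExponent σ τ ξ := by
  rw [laplaceExponent_eq_integral hτ hξ]
  refine intervalIntegral.integral_nonneg hξ fun u hu => ?_
  have : 0 < u := hτ.trans_le hu.1
  positivity

lemma tendsto_laplaceExponent_add {σ τ : ℝ} (hτ : 0 < τ) :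
    Tendsto (fun ξ => laplaceExponent σ τ (ξ + τ)) (𝓝[>] 0) (𝓝 0) := by
  have hc : ContinuousAt (fun ξ => laplaceExponent σ τ (ξ + τ)) 0 := by
    unfold laplaceExponent
    split_ifs with h
    · refine ContinuousAt.log (by fun_prop) ?_
      simp [hτ.ne']
    · refine ContinuousAt.div_const (ContinuousAt.sub (ContinuousAt.rpow_const (by fun_prop)
        (Or.inl (by simp [hτ.ne']))) continuousAt_const) _
  have h0 : laplaceExponent σ τ (0 + τ) = 0 := by
    unfold laplaceExponent
    split_ifs with h <;> simp [hτ.ne']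
  have h := hc.tendsto
  simp only [h0] at h
  exact h.mono_left nhdsWithin_le_nhds

end GGPModel

/-! ### Infinitely divisible distributions on the half-line -/

/-- The `n`-fold convolution of a measure on `[0, ∞)` with itself. -/
noncomputable def convPow (ρ : Measure ℝ≥0) : ℕ → Measure ℝ≥0
  | 0 => Measure.dirac 0
  | n + 1 => ρ.conv (convPow ρ n)

instance convPow_isFinite (ρ : Measure ℝ≥0) [IsFiniteMeasure ρ] (n : ℕ) :
    IsFiniteMeasure (convPow ρ n) := by
  induction n with
  | zero => unfold convPow; infer_instance
  | succ n ih => unfold convPow; infer_instance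

lemma lintegral_convPow (ρ : Measure ℝ≥0) [IsFiniteMeasure ρ] {f : ℝ≥0 → ℝ≥0∞}
    (hf : Measurable f) (h0 : f 0 = 1) (hadd : ∀ x y, f (x + y) = f x * f y) (n : ℕ) :
    ∫⁻ x, f x ∂(convPow ρ n) = (∫⁻ x, f x ∂ρ) ^ n := by
  induction n with
  | zero => simp [convPow, lintegral_dirac, h0]
  | succ n ih =>
    rw [convPow, Measure.lintegral_conv hf]
    simp_rw [hadd, lintegral_const_mul _ hf, ih]
    rw [lintegral_mul_const _ hf, pow_succ']

/-- The compound Poisson distribution with finite jump measure `ρ`. -/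
noncomputable def compoundPoisson (ρ : Measure ℝ≥0) : Measure ℝ≥0 :=
  ENNReal.ofReal (Real.exp (-(ρ univ).toReal)) •
    Measure.sum fun n : ℕ => ENNReal.ofReal (1 / (n.factorial : ℝ)) • convPow ρ n

lemma lintegral_compoundPoisson (ρ : Measure ℝ≥0) [IsFiniteMeasure ρ] {f : ℝ≥0 → ℝ≥0∞}
    (hf : Measurable f) (h0 : f 0 = 1) (hadd : ∀ x y, f (x + y) = f x * f y)
    (h1 : ∀ x, f x ≤ 1) :
    ∫⁻ x, f x ∂(compoundPoisson ρ) =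
      ENNReal.ofReal (Real.exp (-(∫⁻ x, (1 - f x) ∂ρ).toReal)) := by
  have hle : ∫⁻ x, f x ∂ρ ≤ ρ univ := by
    calc _ ≤ ∫⁻ _, 1 ∂ρ := lintegral_mono h1
      _ = _ := by simp
  have hfin : ∫⁻ x, f x ∂ρ ≠ ∞ := ne_top_of_le_ne_top (measure_ne_top _ _) hle
  set r : ℝ := (∫⁻ x, f x ∂ρ).toReal with hr
  have hr0 : 0 ≤ r := ENNReal.toReal_nonneg
  have hsum : ∑' n : ℕ, ENNReal.ofReal (1 / (n.factorial : ℝ)) * (∫⁻ x, f x ∂ρ) ^ n =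
      ENNReal.ofReal (Real.exp r) := by
    have h2 : HasSum (fun n : ℕ => r ^ n / (n.factorial : ℝ)) (Real.exp r) := by
      rw [Real.exp_eq_exp_ℝ]; exact NormedSpace.expSeries_div_hasSum_exp r
    rw [← h2.tsum_eq, ENNReal.ofReal_tsum_of_nonneg (fun n => by positivity) h2.summable]
    congr 1; ext n
    rw [← ENNReal.ofReal_toReal hfin, ← hr, ← ENNReal.ofReal_pow hr0,
      ← ENNReal.ofReal_mul (by positivity)]
    congr 1; ring
  rw [compoundPoisson, lintegral_smul_measure, lintegral_sum_measure]
  simp_rw [lintegral_smul_measure, lintegral_convPow ρ hf h0 hadd, smul_eq_mul]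
  rw [hsum, ← ENNReal.ofReal_mul (by positivity), ← Real.exp_add,
    lintegral_sub hf hfin (Eventually.of_forall h1), lintegral_one,
    ENNReal.toReal_sub_of_le hle (measure_ne_top _ _)]
  congr 2; ring

instance compoundPoisson_isProbability (ρ : Measure ℝ≥0) [IsFiniteMeasure ρ] :
    IsProbabilityMeasure (compoundPoisson ρ) := by
  constructor
  have h := lintegral_compoundPoisson ρ (f := fun _ => 1) measurable_const rfl (by simp) (by simp)
  simpa using h

lemma lintegral_prod_infinitePi {Ω : Type*} [MeasurableSpace Ω] (μ : ℕ → Measure Ω)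
    [∀ k, IsProbabilityMeasure (μ k)] {f : Ω → ℝ≥0∞} (hf : Measurable f) (n : ℕ) :
    ∫⁻ ω, ∏ k ∈ Finset.range n, f (ω k) ∂(Measure.infinitePi μ) =
      ∏ k ∈ Finset.range n, ∫⁻ x, f x ∂(μ k) := by
  rw [ProbabilityTheory.lintegral_prod_eq_prod_lintegral_of_indepFun (Finset.range n)
    (fun k (ω : ℕ → Ω) => f (ω k)) (ProbabilityTheory.iIndepFun_infinitePi (fun _ => hf))
    (fun k => hf.comp (measurable_pi_apply k))]
  refine Finset.prod_congr rfl fun k _ => ?_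
  rw [← lintegral_map (g := fun ω : ℕ → Ω => ω k) hf (measurable_pi_apply k),
    Measure.infinitePi_map_eval]

/-- Existence of the infinitely divisible distribution with Lévy measure `ν` and no drift: it is
the law of the sum of independent compound Poisson variables whose jump measures are finite and
sum to `ν`. The condition on `Ψ` at zero makes the sum finite almost surely. -/
lemma exists_laplace_eq (ν : Measure ℝ≥0) [SFinite ν] (Ψ : ℝ → ℝ)
    (hΨ0 : ∀ ξ, 0 ≤ ξ → 0 ≤ Ψ ξ)
    (hΨ : ∀ ξ, 0 ≤ ξ → ∫⁻ x, ENNReal.ofReal (1 - Real.exp (-(ξ * x))) ∂ν = ENNReal.ofReal (Ψ ξ))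
    (hlim : Tendsto Ψ (𝓝[>] 0) (𝓝 0)) :
    ∃ μ : Measure ℝ, IsProbabilityMeasure μ ∧ μ (Iio 0) = 0 ∧ ∀ ξ : ℝ, 0 ≤ ξ →
      ∫⁻ x, ENNReal.ofReal (Real.exp (-(ξ * x))) ∂μ = ENNReal.ofReal (Real.exp (-Ψ ξ)) := by
  let ρ : ℕ → Measure ℝ≥0 := sfiniteSeq ν
  let P : Measure (ℕ → ℝ≥0) := Measure.infinitePi fun k => compoundPoisson (ρ k)
  let S : (ℕ → ℝ≥0) → ℝ≥0∞ := fun ω => ∑' k, (ω k : ℝ≥0∞)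
  have hS : Measurable S := by fun_prop
  let e : ℝ → ℝ≥0 → ℝ≥0∞ := fun ξ x => ENNReal.ofReal (Real.exp (-(ξ * x)))
  have he : ∀ ξ, Measurable (e ξ) := fun ξ => by fun_prop
  let a : ℝ → ℕ → ℝ≥0∞ := fun ξ k => ∫⁻ x, (1 - e ξ x) ∂(ρ k)
  have ha : ∀ ξ, 0 ≤ ξ → ∑' k, a ξ k = ENNReal.ofReal (Ψ ξ) := by
    intro ξ hξ
    rw [← hΨ ξ hξ, ← sum_sfiniteSeq ν, lintegral_sum_measure]
    refine tsum_congr fun k => lintegral_congr fun x => ?_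
    rw [ENNReal.ofReal_sub _ (Real.exp_pos _).le, ENNReal.ofReal_one]
  have hlap : ∀ ξ, 0 ≤ ξ → ∀ k, ∫⁻ x, e ξ x ∂(compoundPoisson (ρ k)) =
      ENNReal.ofReal (Real.exp (-(a ξ k).toReal)) := by
    intro ξ hξ k
    refine lintegral_compoundPoisson (ρ k) (he ξ) (by simp [e]) (fun x y => ?_) fun x => ?_
    · simp only [e]
      rw [← ENNReal.ofReal_mul (by positivity), ← Real.exp_add, NNReal.coe_add]
      congr 2; ring
    · simp only [e]
      rw [ENNReal.ofReal_le_one, Real.exp_le_one_iff]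
      have : 0 ≤ ξ * (x : ℝ) := by positivity
      linarith
  have hprod : ∀ ξ, 0 ≤ ξ → ∀ n, ∫⁻ ω, ∏ k ∈ Finset.range n, e ξ (ω k) ∂P =
      ENNReal.ofReal (Real.exp (-∑ k ∈ Finset.range n, (a ξ k).toReal)) := by
    intro ξ hξ n
    rw [lintegral_prod_infinitePi _ (he ξ), ← Finset.sum_neg_distrib, Real.exp_sum,
      ENNReal.ofReal_prod_of_nonneg (fun _ _ => (Real.exp_pos _).le)]
    exact Finset.prod_congr rfl fun k _ => hlap ξ hξ k
  -- for `ξ > 0` the partial products converge to `exp (-ξ S)`, read as zero where `S` is infinite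
  have hpt : ∀ ξ, 0 < ξ → ∀ ω, Tendsto (fun n => ∏ k ∈ Finset.range n, e ξ (ω k)) atTop
      (𝓝 ({ω | S ω ≠ ∞}.indicator
        (fun ω => ENNReal.ofReal (Real.exp (-(ξ * (S ω).toReal)))) ω)) := by
    intro ξ hξ ω
    have hpe : ∀ n, ∏ k ∈ Finset.range n, e ξ (ω k) =
        ENNReal.ofReal (Real.exp (-(ξ * ∑ k ∈ Finset.range n, (ω k : ℝ)))) := by
      intro n
      rw [Finset.mul_sum, ← Finset.sum_neg_distrib, Real.exp_sum,
        ENNReal.ofReal_prod_of_nonneg (fun _ _ => (Real.exp_pos _).le)]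
    simp_rw [hpe]
    by_cases hω : S ω = ∞
    · rw [indicator_of_notMem (by simpa using hω), ← ENNReal.ofReal_zero]
      refine ENNReal.tendsto_ofReal ?_
      have hns : ¬ Summable fun k => (ω k : ℝ) := by
        rw [NNReal.summable_coe]
        exact fun h => ENNReal.tsum_coe_ne_top_iff_summable.2 h hω
      have h := not_summable_iff_tendsto_nat_atTop_of_nonneg (fun k => (ω k).coe_nonneg) |>.1 hns
      exact Real.tendsto_exp_neg_atTop_nhds_zero.comp (h.const_mul_atTop hξ)
    · rw [indicator_of_mem (by simpa using hω)]
      refine ENNReal.tendsto_ofReal ((Real.continuous_exp.tendsto _).comp ?_)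
      have hs : Summable ω := ENNReal.tsum_coe_ne_top_iff_summable.1 hω
      have hS' : (S ω).toReal = ∑' k, (ω k : ℝ) := by
        simp only [S]
        rw [← ENNReal.coe_tsum hs, ENNReal.coe_toReal, NNReal.coe_tsum]
      rw [hS']
      exact ((NNReal.summable_coe.2 hs).hasSum.tendsto_sum_nat.const_mul ξ).neg
  have hSm : MeasurableSet {ω | S ω ≠ ∞} := (measurableSet_eq_fun hS measurable_const).compl
  have hkey : ∀ ξ, 0 < ξ → ∫⁻ ω in {ω | S ω ≠ ∞}, ENNReal.ofReal (Real.exp (-(ξ * (S ω).toReal))) ∂P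
      = ENNReal.ofReal (Real.exp (-Ψ ξ)) := by
    intro ξ hξ
    rw [← lintegral_indicator hSm]
    have h1 := tendsto_lintegral_of_dominated_convergence (μ := P) (fun _ => 1)
      (F := fun n ω => ∏ k ∈ Finset.range n, e ξ (ω k))
      (fun n => Finset.measurable_fun_prod _ fun k _ => (he ξ).comp (measurable_pi_apply k))
      (fun n => Eventually.of_forall fun ω => Finset.prod_le_one' fun k _ => by
        simp only [e]
        rw [ENNReal.ofReal_le_one, Real.exp_le_one_iff]
        have : 0 ≤ ξ * (ω k : ℝ) := by positivity
        linarith) (by simp) (Eventually.of_forall (hpt ξ hξ))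
    refine tendsto_nhds_unique h1 ?_
    simp_rw [hprod ξ hξ.le]
    refine ENNReal.tendsto_ofReal ((Real.continuous_exp.tendsto _).comp (Tendsto.neg ?_))
    have hne : ∑' k, a ξ k ≠ ∞ := by rw [ha ξ hξ.le]; exact ENNReal.ofReal_ne_top
    have h2 := (ENNReal.summable_toReal hne).hasSum.tendsto_sum_nat
    rwa [← ENNReal.tsum_toReal_eq (fun k => ENNReal.ne_top_of_tsum_ne_top hne k), ha ξ hξ.le,
      ENNReal.toReal_ofReal (hΨ0 ξ hξ.le)] at h2
  have hSfin : ∀ᵐ ω ∂P, S ω ≠ ∞ := by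
    have h1 : 1 ≤ P {ω | S ω ≠ ∞} := by
      have ht : Tendsto (fun ξ => ENNReal.ofReal (Real.exp (-Ψ ξ))) (𝓝[>] 0) (𝓝 1) := by
        have := ENNReal.tendsto_ofReal ((Real.continuous_exp.tendsto _).comp hlim.neg)
        simpa using this
      refine le_of_tendsto ht ?_
      filter_upwards [self_mem_nhdsWithin] with ξ hξ
      have hξ : 0 < ξ := hξ
      rw [← hkey ξ hξ]
      calc _ ≤ ∫⁻ _ in {ω | S ω ≠ ∞}, 1 ∂P := by
            refine lintegral_mono fun ω => ?_
            rw [ENNReal.ofReal_le_one, Real.exp_le_one_iff]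
            have : 0 ≤ ξ * (S ω).toReal := by positivity
            linarith
        _ = _ := by simp
    exact (prob_compl_eq_zero_iff hSm).2 (le_antisymm prob_le_one h1)
  have hmeas : Measurable fun ω => (S ω).toReal := hS.ennreal_toReal
  refine ⟨P.map fun ω => (S ω).toReal, Measure.isProbabilityMeasure_map hmeas.aemeasurable, ?_, ?_⟩
  · rw [Measure.map_apply hmeas measurableSet_Iio]
    convert measure_empty (μ := P) using 2
    ext ω
    simp
  · intro ξ hξ
    rw [lintegral_map (by fun_prop) hmeas]
    rcases hξ.eq_or_lt with rfl | hξ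
    · have h0 : Ψ 0 = 0 := by
        refine le_antisymm ?_ (hΨ0 0 le_rfl)
        have h := hΨ 0 le_rfl
        simpa using h.symm
      simp [h0]
    · rw [← hkey ξ hξ, Measure.restrict_eq_self_of_ae_mem (s := {ω | S ω ≠ ∞}) hSfin]

namespace GGPModel

lemma exists_isTiltedStable {σ τ s : ℝ} (hσ : σ < 1) (hτ : 0 < τ) (hs : 0 < s) :
    ∃ μ, IsTiltedStable σ τ s μ := by
  have hG : 0 < Real.Gamma (1 - σ) := Real.Gamma_pos_of_pos (by linarith)
  let d : ℝ → ℝ≥0∞ := fun w =>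
    ENNReal.ofReal (s / Real.Gamma (1 - σ) * (Real.exp (-(τ * w)) * w ^ (-1 - σ)))
  have hd : Measurable d := by fun_prop
  let ν : Measure ℝ≥0 := ((volume.restrict (Ioi 0)).withDensity d).map Real.toNNReal
  refine exists_laplace_eq ν (fun ξ => s * laplaceExponent σ τ (ξ + τ))
    (fun ξ hξ => mul_nonneg hs.le (laplaceExponent_nonneg hτ (by linarith))) (fun ξ hξ => ?_) ?_
  · rw [lintegral_map (by fun_prop) (by fun_prop),
      lintegral_withDensity_eq_lintegral_mul _ hd (by fun_prop)]
    have h : ∀ w ∈ Ioi (0 : ℝ),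
        (d * fun w : ℝ => ENNReal.ofReal (1 - Real.exp (-(ξ * (w.toNNReal : ℝ))))) w =
        ENNReal.ofReal (s / Real.Gamma (1 - σ)) *
        ENNReal.ofReal ((1 - Real.exp (-(ξ * w))) * (Real.exp (-(τ * w)) * w ^ (-1 - σ))) := by
      intro w hw
      have hw : 0 < w := hw
      simp only [Pi.mul_apply, d]
      rw [Real.coe_toNNReal _ hw.le, ← ENNReal.ofReal_mul (by positivity),
        ← ENNReal.ofReal_mul (by positivity)]
      congr 1; ring
    rw [setLIntegral_congr_fun measurableSet_Ioi h, lintegral_const_mul _ (by fun_prop),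
      lintegral_levy hσ hτ hξ, ← ENNReal.ofReal_mul (by positivity)]
    congr 1; field_simp
  · simpa using (tendsto_laplaceExponent_add hτ).const_mul s

lemma isTiltedStable_tiltedStable {σ τ s : ℝ} (hσ : σ < 1) (hτ : 0 < τ) (hs : 0 < s) :
    IsTiltedStable σ τ s (tiltedStable σ τ s) := by
  have h := exists_isTiltedStable hσ hτ hs
  rw [tiltedStable, dif_pos h]
  exact h.choose_spec

end GGPModel

/-! ### Degrees -/

namespace FiniteMultigraph

lemma one_le_deg (G : FiniteMultigraph) {i : ℕ} (hi : i ∈ G.verts) : 1 ≤ G.deg i := G.deg_pos i hi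

lemma deg_le_totalDeg (G : FiniteMultigraph) {i : ℕ} (hi : i ∈ G.verts) :
    G.deg i ≤ G.totalDeg :=
  Finset.single_le_sum (f := G.deg) (fun _ _ => Nat.zero_le _) hi

lemma numVerts_le_totalDeg (G : FiniteMultigraph) : G.numVerts ≤ G.totalDeg := by
  have h := Finset.card_nsmul_le_sum G.verts G.deg 1 fun i hi => G.one_le_deg hi
  simpa [numVerts, totalDeg] using h

lemma sum_log_deg (G : FiniteMultigraph) :
    ∑ i ∈ G.verts, Real.log (G.deg i) = G.sumLogDeg := by
  have hmaps : ∀ i ∈ G.verts, G.deg i ∈ Finset.Icc 1 G.totalDeg := fun i hi =>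
    Finset.mem_Icc.2 ⟨G.one_le_deg hi, G.deg_le_totalDeg hi⟩
  rw [← Finset.sum_fiberwise_of_maps_to hmaps, sumLogDeg]
  symm
  have hsub : Finset.Icc 2 G.totalDeg ⊆ Finset.Icc 1 G.totalDeg :=
    Finset.Icc_subset_Icc (by norm_num) le_rfl
  calc _ = ∑ j ∈ Finset.Icc 1 G.totalDeg, (G.numDeg j : ℝ) * Real.log j := by
        refine Finset.sum_subset hsub fun j hj hj' => ?_
        have hj1 : j = 1 := by simp only [Finset.mem_Icc] at hj hj'; omega
        simp [hj1]
    _ = _ := by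
        refine Finset.sum_congr rfl fun j _ => ?_
        rw [Finset.sum_congr rfl fun i hi => by rw [(Finset.mem_filter.1 hi).2],
          Finset.sum_const, nsmul_eq_mul, numDeg]

lemma sumLogDeg_le (G : FiniteMultigraph) :
    G.sumLogDeg ≤ (G.numVerts : ℝ) * Real.log G.totalDeg := by
  rw [← sum_log_deg]
  have h := Finset.sum_le_card_nsmul G.verts (fun i => Real.log (G.deg i))
    (Real.log G.totalDeg) fun i hi => by
      refine Real.log_le_log (by exact_mod_cast G.one_le_deg hi) ?_
      exact_mod_cast G.deg_le_totalDeg hi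
  simpa [numVerts] using h

lemma cast_totalDeg (G : FiniteMultigraph) :
    (G.totalDeg : ℝ) = ∑ i ∈ G.verts, (G.deg i : ℝ) := by
  rw [totalDeg]; push_cast; rfl

/-- The factor `∏ Γ(D_i - σ) / Γ(1 - σ)` of the likelihood. -/
noncomputable def degFactor (G : FiniteMultigraph) (σ : ℝ) : ℝ :=
  ∏ i ∈ G.verts, (Real.Gamma ((G.deg i : ℝ) - σ) / Real.Gamma (1 - σ))

lemma Gamma_deg_sub_div_pos (G : FiniteMultigraph) {σ : ℝ} (hσ : σ < 1) {i : ℕ}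
    (hi : i ∈ G.verts) : 0 < Real.Gamma ((G.deg i : ℝ) - σ) / Real.Gamma (1 - σ) := by
  have h : (1 : ℝ) ≤ G.deg i := by exact_mod_cast G.one_le_deg hi
  exact div_pos (Real.Gamma_pos_of_pos (by linarith)) (Real.Gamma_pos_of_pos (by linarith))

lemma degFactor_pos (G : FiniteMultigraph) {σ : ℝ} (hσ : σ < 1) : 0 < G.degFactor σ :=
  Finset.prod_pos fun _ hi => G.Gamma_deg_sub_div_pos hσ hi

lemma Gamma_deg_pos (G : FiniteMultigraph) {i : ℕ} (hi : i ∈ G.verts) :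
    0 < Real.Gamma (G.deg i) :=
  Real.Gamma_pos_of_pos (by exact_mod_cast G.one_le_deg hi)

lemma degFactor_le (G : FiniteMultigraph) {σ : ℝ} (h0 : 0 ≤ σ) (h1 : σ < 1) :
    G.degFactor σ ≤ (∏ i ∈ G.verts, Real.Gamma (G.deg i)) * Real.exp (-(σ * G.sumLogDeg)) := by
  rw [← sum_log_deg, Finset.mul_sum, ← Finset.sum_neg_distrib, Real.exp_sum,
    ← Finset.prod_mul_distrib]
  exact Finset.prod_le_prod (fun i hi => (G.Gamma_deg_sub_div_pos h1 hi).le)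
    fun i hi => Gamma_sub_div_le h0 h1 (G.one_le_deg hi)

lemma le_degFactor (G : FiniteMultigraph) {σ : ℝ} (h0 : 0 ≤ σ) (h1 : σ ≤ 1 / 2) :
    (∏ i ∈ G.verts, Real.Gamma (G.deg i)) * Real.exp (-(4 * σ * G.sumLogDeg)) ≤
      G.degFactor σ := by
  rw [← sum_log_deg, Finset.mul_sum, ← Finset.sum_neg_distrib, Real.exp_sum,
    ← Finset.prod_mul_distrib]
  exact Finset.prod_le_prod (fun i hi => mul_nonneg (G.Gamma_deg_pos hi).le (Real.exp_pos _).le)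
    fun i hi => le_Gamma_sub_div h0 h1 (G.one_le_deg hi)

/-- The reference value to which the likelihood is compared: its supremum over `τ` and `s` for
small `σ > 0`, up to factors `exp (γ N log D*)` with `γ` small. -/
noncomputable def baseline (G : FiniteMultigraph) : ℝ :=
  Real.exp ((G.totalDeg : ℝ) / 2) * (1 / √(2 * (G.totalDeg : ℝ))) ^ G.totalDeg *
    (G.numVerts : ℝ) ^ G.numVerts * ∏ i ∈ G.verts, Real.Gamma (G.deg i)

lemma baseline_pos (G : FiniteMultigraph) (hN : 1 ≤ G.numVerts) : 0 < G.baseline := by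
  have hD : (0 : ℝ) < G.totalDeg := by exact_mod_cast hN.trans G.numVerts_le_totalDeg
  have hN' : (0 : ℝ) < G.numVerts := by exact_mod_cast hN
  have := Finset.prod_pos fun i (hi : i ∈ G.verts) => G.Gamma_deg_pos hi
  unfold baseline
  positivity

end FiniteMultigraph

/-! ### Upper bounds for the likelihood -/

namespace GGPModel

lemma totalDeg_sub_pos (G : FiniteMultigraph) (hN : 1 ≤ G.numVerts) {σ : ℝ} (hσ : σ < 1) :
    0 < (G.totalDeg : ℝ) - σ * (G.numVerts : ℝ) := by
  have h1 : (G.numVerts : ℝ) ≤ G.totalDeg := by exact_mod_cast G.numVerts_le_totalDeg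
  have h2 : (1 : ℝ) ≤ G.numVerts := by exact_mod_cast hN
  nlinarith

/-- Replacing the Gaussian factor by its exponential majorant tangent at `c` makes both integrals
explicit. -/
lemma likelihood_le (G : FiniteMultigraph) (hN : 1 ≤ G.numVerts) {σ τ s c : ℝ} (hσ : σ < 1)
    (hτ : 0 < τ) (hs : 0 < s) (hc : 0 < c) :
    likelihood G (σ, τ, s) ≤ ENNReal.ofReal (Real.exp (c ^ 2) *
      (s ^ G.numVerts * Real.exp (-(s * laplaceExponent σ τ (2 * c + τ)))) *
      ((1 / (2 * c + τ)) ^ ((G.totalDeg : ℝ) - σ * (G.numVerts : ℝ)) * G.degFactor σ)) := by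
  have hp := totalDeg_sub_pos G hN hσ
  obtain ⟨-, -, hL⟩ := isTiltedStable_tiltedStable hσ hτ hs
  have hPpos := G.degFactor_pos hσ
  simp only [likelihood]
  set p : ℝ := (G.totalDeg : ℝ) - σ * (G.numVerts : ℝ) with hpdef
  have hG : 0 < Real.Gamma p := Real.Gamma_pos_of_pos hp
  have hin : ∀ x ∈ Ioi (0 : ℝ), ∫⁻ y, ENNReal.ofReal (Real.exp (-(x + y) ^ 2) *
      (x ^ (p - 1) * Real.exp (-(τ * x)) / Real.Gamma p)) ∂(tiltedStable σ τ s) ≤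
      ENNReal.ofReal (Real.exp (c ^ 2) *
        Real.exp (-(s * laplaceExponent σ τ (2 * c + τ))) / Real.Gamma p) *
      ENNReal.ofReal (x ^ (p - 1) * Real.exp (-((2 * c + τ) * x))) := by
    intro x hx
    have hx : 0 < x := hx
    calc _ ≤ ∫⁻ y, ENNReal.ofReal (Real.exp (c ^ 2) / Real.Gamma p *
            (x ^ (p - 1) * Real.exp (-((2 * c + τ) * x)))) *
            ENNReal.ofReal (Real.exp (-(2 * c * y))) ∂(tiltedStable σ τ s) := by
          refine lintegral_mono fun y => ?_
          rw [← ENNReal.ofReal_mul (by positivity)]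
          refine ENNReal.ofReal_le_ofReal ?_
          have h1 : Real.exp (-(x + y) ^ 2) ≤
              Real.exp (c ^ 2) * Real.exp (-(2 * c * x)) * Real.exp (-(2 * c * y)) := by
            rw [← Real.exp_add, ← Real.exp_add, Real.exp_le_exp]
            nlinarith [sq_nonneg (x + y - c)]
          have h2 : Real.exp (-((2 * c + τ) * x)) =
              Real.exp (-(2 * c * x)) * Real.exp (-(τ * x)) := by
            rw [← Real.exp_add]; congr 1; ring
          calc _ ≤ Real.exp (c ^ 2) * Real.exp (-(2 * c * x)) * Real.exp (-(2 * c * y)) *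
                (x ^ (p - 1) * Real.exp (-(τ * x)) / Real.Gamma p) := by gcongr
            _ = _ := by rw [h2]; ring
      _ = _ := by
          rw [lintegral_const_mul _ (by fun_prop), hL (2 * c) (by positivity),
            ← ENNReal.ofReal_mul (by positivity), ← ENNReal.ofReal_mul (by positivity)]
          congr 1; ring
  calc _ ≤ ENNReal.ofReal (s ^ G.numVerts * G.degFactor σ) *
        (ENNReal.ofReal (Real.exp (c ^ 2) *
          Real.exp (-(s * laplaceExponent σ τ (2 * c + τ))) / Real.Gamma p) *
        ENNReal.ofReal ((1 / (2 * c + τ)) ^ p * Real.Gamma p)) := by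
        have h := setLIntegral_mono' (μ := volume) measurableSet_Ioi hin
        rw [lintegral_const_mul _ (by fun_prop),
          lintegral_rpow_mul_exp_neg_mul_Ioi hp (by positivity : 0 < 2 * c + τ)] at h
        exact mul_le_mul_right h _
    _ = _ := by
        rw [← ENNReal.ofReal_mul (by positivity), ← ENNReal.ofReal_mul (by positivity)]
        congr 1
        field_simp

/-- A single vertex contributes a bounded factor, uniformly in `σ` and `τ`: in the integral
representations of both sides, `w ^ d * exp (-2 w) ≤ d! * (1 - exp (-2 w))`. -/
lemma Gamma_sub_mul_le_laplaceExponent {σ τ : ℝ} (hσ : σ < 1) (hτ : 0 < τ) {d : ℕ} (hd : 1 ≤ d) :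
    (1 / (2 + τ)) ^ ((d : ℝ) - σ) * (Real.Gamma ((d : ℝ) - σ) / Real.Gamma (1 - σ)) ≤
      d.factorial * laplaceExponent σ τ (2 + τ) := by
  have hd' : (1 : ℝ) ≤ d := by exact_mod_cast hd
  have hG : 0 < Real.Gamma (1 - σ) := Real.Gamma_pos_of_pos (by linarith)
  have hψ := laplaceExponent_nonneg (σ := σ) hτ (by linarith : τ ≤ 2 + τ)
  have h := calc
    ENNReal.ofReal ((1 / (2 + τ)) ^ ((d : ℝ) - σ) * Real.Gamma ((d : ℝ) - σ)) =
        ∫⁻ w in Ioi (0 : ℝ),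
          ENNReal.ofReal (w ^ ((d : ℝ) - σ - 1) * Real.exp (-((2 + τ) * w))) :=
      (lintegral_rpow_mul_exp_neg_mul_Ioi (by linarith) (by linarith)).symm
    _ ≤ ∫⁻ w in Ioi (0 : ℝ), ENNReal.ofReal (d.factorial : ℝ) *
        ENNReal.ofReal ((1 - Real.exp (-(2 * w))) * (Real.exp (-(τ * w)) * w ^ (-1 - σ))) := by
      refine setLIntegral_mono' measurableSet_Ioi fun w hw => ?_
      have hw : 0 < w := hw
      rw [← ENNReal.ofReal_mul (by positivity)]
      refine ENNReal.ofReal_le_ofReal ?_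
      have e1 : w ^ ((d : ℝ) - σ - 1) = w ^ d * w ^ (-1 - σ) := by
        rw [← Real.rpow_natCast, ← Real.rpow_add hw]; congr 1; ring
      have e2 : Real.exp (-((2 + τ) * w)) = Real.exp (-(2 * w)) * Real.exp (-(τ * w)) := by
        rw [← Real.exp_add]; congr 1; ring
      have e3 : w ^ d * Real.exp (-(2 * w)) ≤ d.factorial * (1 - Real.exp (-(2 * w))) := by
        have h1 : (2 * w) ^ d / d.factorial ≤ Real.exp (2 * w) - 1 := by
          have h2 := Real.sum_le_exp_of_nonneg (by positivity : 0 ≤ 2 * w) (d + 1)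
          rw [Finset.sum_range_succ] at h2
          have h3 : (1 : ℝ) ≤ ∑ i ∈ Finset.range d, (2 * w) ^ i / i.factorial := by
            have := Finset.single_le_sum (f := fun i : ℕ => (2 * w) ^ i / (i.factorial : ℝ))
              (fun i _ => by positivity) (Finset.mem_range.2 hd)
            simpa using this
          linarith
        have h4 : w ^ d ≤ (2 * w) ^ d := by gcongr; linarith
        rw [div_le_iff₀ (by positivity)] at h1
        have h5 : Real.exp (-(2 * w)) * Real.exp (2 * w) = 1 := by rw [← Real.exp_add]; simp
        calc _ ≤ (Real.exp (2 * w) - 1) * d.factorial * Real.exp (-(2 * w)) := by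
              gcongr; linarith
          _ = d.factorial * (Real.exp (-(2 * w)) * Real.exp (2 * w) - Real.exp (-(2 * w))) := by
              ring
          _ = _ := by rw [h5]
      calc _ = w ^ d * Real.exp (-(2 * w)) * (Real.exp (-(τ * w)) * w ^ (-1 - σ)) := by
            rw [e1, e2]; ring
        _ ≤ d.factorial * (1 - Real.exp (-(2 * w))) * (Real.exp (-(τ * w)) * w ^ (-1 - σ)) := by
            gcongr
        _ = _ := by ring
    _ = ENNReal.ofReal (d.factorial * (Real.Gamma (1 - σ) * laplaceExponent σ τ (2 + τ))) := by
      rw [lintegral_const_mul _ (by fun_prop), lintegral_levy hσ hτ zero_le_two,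
        ← ENNReal.ofReal_mul (by positivity)]
  rw [ENNReal.ofReal_le_ofReal_iff (by positivity)] at h
  rw [mul_div_assoc', div_le_iff₀ hG]
  linarith

/-- The likelihood of a given multigraph is a bounded function of the parameters. -/
lemma likelihood_le_const (G : FiniteMultigraph) (hN : 1 ≤ G.numVerts) {σ τ s : ℝ} (hσ : σ < 1)
    (hτ : 0 < τ) (hs : 0 < s) :
    likelihood G (σ, τ, s) ≤ ENNReal.ofReal (Real.exp 1 *
      ((G.numVerts : ℝ) ^ G.numVerts * ∏ i ∈ G.verts, ((G.deg i).factorial : ℝ))) := by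
  refine (likelihood_le G hN hσ hτ hs one_pos).trans (ENNReal.ofReal_le_ofReal ?_)
  have hψ := laplaceExponent_nonneg (σ := σ) hτ (by linarith : τ ≤ 2 + τ)
  have h1 : (1 / (2 + τ)) ^ ((G.totalDeg : ℝ) - σ * (G.numVerts : ℝ)) * G.degFactor σ ≤
      (∏ i ∈ G.verts, ((G.deg i).factorial : ℝ)) * laplaceExponent σ τ (2 + τ) ^ G.numVerts := by
    have e : (G.totalDeg : ℝ) - σ * (G.numVerts : ℝ) = ∑ i ∈ G.verts, ((G.deg i : ℝ) - σ) := by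
      rw [G.cast_totalDeg, Finset.sum_sub_distrib, Finset.sum_const, nsmul_eq_mul,
        FiniteMultigraph.numVerts]
      ring
    rw [e, Real.rpow_sum_of_pos (by positivity), FiniteMultigraph.degFactor,
      ← Finset.prod_mul_distrib, FiniteMultigraph.numVerts, ← Finset.prod_const,
      ← Finset.prod_mul_distrib]
    refine Finset.prod_le_prod (fun i hi => ?_) fun i hi =>
      Gamma_sub_mul_le_laplaceExponent hσ hτ (G.one_le_deg hi)
    have := G.Gamma_deg_sub_div_pos hσ hi
    positivity
  have h2 := pow_mul_exp_neg_le (mul_nonneg hs.le hψ) G.numVerts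
  simp only [one_pow, mul_one]
  calc _ ≤ Real.exp 1 * (s ^ G.numVerts * Real.exp (-(s * laplaceExponent σ τ (2 + τ)))) *
        ((∏ i ∈ G.verts, ((G.deg i).factorial : ℝ)) *
          laplaceExponent σ τ (2 + τ) ^ G.numVerts) := by gcongr
    _ = Real.exp 1 * (((s * laplaceExponent σ τ (2 + τ)) ^ G.numVerts *
          Real.exp (-(s * laplaceExponent σ τ (2 + τ)))) *
          ∏ i ∈ G.verts, ((G.deg i).factorial : ℝ)) := by rw [mul_pow]; ring
    _ ≤ _ := by gcongr

/-- For `0 < σ < 1` the likelihood is smaller than the baseline by the factor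
`∏ D_i ^ (-σ)`, uniformly in the other parameters. -/
lemma likelihood_le_baseline (G : FiniteMultigraph) (hN : 1 ≤ G.numVerts) {σ τ s : ℝ}
    (h0 : 0 < σ) (h1 : σ < 1) (hτ : 0 < τ) (hs : 0 < s) :
    likelihood G (σ, τ, s) ≤
      ENNReal.ofReal (G.baseline * Real.exp (-(σ * G.sumLogDeg))) := by
  have hDN := G.numVerts_le_totalDeg
  have hD : (0 : ℝ) < G.totalDeg := by exact_mod_cast hN.trans hDN
  set N := G.numVerts
  set D := G.totalDeg
  -- the tangent point is the maximum of `x ^ D * exp (-x ^ 2)`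
  obtain ⟨r, hr⟩ : ∃ r, r = √(2 * (D : ℝ)) := ⟨_, rfl⟩
  have hr0 : 0 < r := by rw [hr]; positivity
  have hr2 : (r / 2) ^ 2 = (D : ℝ) / 2 := by
    rw [div_pow, hr, Real.sq_sqrt (by positivity)]; ring
  refine (likelihood_le G hN h1 hτ hs (half_pos hr0)).trans (ENNReal.ofReal_le_ofReal ?_)
  rw [hr2, mul_div_cancel₀ r two_ne_zero]
  have hψ := le_laplaceExponent h0 h1 hτ (by linarith : τ ≤ r + τ)
  rw [add_sub_cancel_right] at hψ
  set ψ := laplaceExponent σ τ (r + τ)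
  set ξ := r + τ with hξ
  have hξ0 : 0 < ξ := by positivity
  have hψ0 : 0 < ψ := lt_of_lt_of_le (by positivity) hψ
  have h2 : s ^ N * Real.exp (-(s * ψ)) ≤ (N : ℝ) ^ N * (1 / ψ) ^ N := by
    have := pow_mul_exp_neg_le (mul_nonneg hs.le hψ0.le) N
    rw [one_div, inv_pow, ← div_eq_mul_inv, le_div_iff₀ (by positivity)]
    calc _ = (s * ψ) ^ N * Real.exp (-(s * ψ)) := by rw [mul_pow]; ring
      _ ≤ _ := this
  have h3 : (1 / ψ) ^ N * (1 / ξ) ^ ((D : ℝ) - σ * N) ≤ (1 / r) ^ D := by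
    calc _ ≤ (1 / (r * ξ ^ (σ - 1))) ^ N * (1 / ξ) ^ ((D : ℝ) - σ * N) := by gcongr
      _ = (1 / r) ^ N * (1 / ξ) ^ (D - N) := by
          have e1 : (1 / (r * ξ ^ (σ - 1))) ^ N = (1 / r) ^ N * (1 / ξ) ^ ((σ - 1) * N) := by
            rw [Real.rpow_mul (by positivity), Real.rpow_natCast, ← mul_pow, one_div ξ,
              Real.inv_rpow hξ0.le, one_div, one_div, mul_inv]
          rw [e1, mul_assoc, ← Real.rpow_add (by positivity), ← Real.rpow_natCast (1 / ξ),
            Nat.cast_sub hDN]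
          congr 2; ring
      _ ≤ (1 / r) ^ N * (1 / r) ^ (D - N) := by
          gcongr; linarith
      _ = _ := by rw [← pow_add, Nat.add_sub_cancel' hDN]
  have h4 := G.degFactor_le h0.le h1
  have h5 := G.degFactor_pos h1
  calc _ ≤ Real.exp (D / 2) * ((N : ℝ) ^ N * (1 / ψ) ^ N) *
        ((1 / ξ) ^ ((D : ℝ) - σ * N) * G.degFactor σ) := by gcongr
    _ = Real.exp (D / 2) * ((1 / ψ) ^ N * (1 / ξ) ^ ((D : ℝ) - σ * N)) * (N : ℝ) ^ N *
        G.degFactor σ := by ring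
    _ ≤ Real.exp (D / 2) * (1 / r) ^ D * (N : ℝ) ^ N *
        ((∏ i ∈ G.verts, Real.Gamma (G.deg i)) * Real.exp (-(σ * G.sumLogDeg))) := by gcongr
    _ = _ := by rw [FiniteMultigraph.baseline, hr]; ring

end GGPModel

/-! ### A lower bound for the likelihood -/

namespace GGPModel

/-- The Gaussian factor `exp (-y ^ 2)` costs little under the tilted stable distribution: the
levels `y > b = (n + 1) / (2 x)` contribute at most `exp (-2 x b)` to the Laplace transform at
`2 x`, which is less than half of it. -/
lemma le_lintegral_tiltedStable {σ τ s x n : ℝ} (hσ : σ < 1) (hτ : 0 < τ) (hs : 0 < s)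
    (hx : 0 < x) (hn : 0 ≤ n) (hψ : s * laplaceExponent σ τ (2 * x + τ) ≤ n) :
    ENNReal.ofReal (Real.exp (-(((n + 1) / (2 * x)) ^ 2 + n + 1))) ≤
      ∫⁻ y, ENNReal.ofReal (Real.exp (-(2 * x * y + y ^ 2))) ∂(tiltedStable σ τ s) := by
  obtain ⟨hprob, hneg, hL⟩ := isTiltedStable_tiltedStable hσ hτ hs
  obtain ⟨b, hb⟩ : ∃ b, b = (n + 1) / (2 * x) := ⟨_, rfl⟩
  have hb0 : 0 < b := by rw [hb]; positivity
  have hxb : 2 * x * b = n + 1 := by rw [hb]; field_simp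
  rw [← hb]
  set μ := tiltedStable σ τ s
  set J := ∫⁻ y, ENNReal.ofReal (Real.exp (-(2 * x * y + y ^ 2))) ∂μ with hJ
  have hnonneg : ∀ᵐ y ∂μ, 0 ≤ y := by
    rw [ae_iff]; convert hneg using 2; ext y; simp
  have h1 : ENNReal.ofReal (Real.exp (-(s * laplaceExponent σ τ (2 * x + τ)))) ≤
      ENNReal.ofReal (Real.exp (b ^ 2)) * J + ENNReal.ofReal (Real.exp (-(n + 1))) := by
    rw [← hL (2 * x) (by positivity)]
    calc _ ≤ ∫⁻ y, (ENNReal.ofReal (Real.exp (b ^ 2)) *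
            ENNReal.ofReal (Real.exp (-(2 * x * y + y ^ 2))) +
            ENNReal.ofReal (Real.exp (-(n + 1)))) ∂μ := by
          refine lintegral_mono_ae ?_
          filter_upwards [hnonneg] with y hy
          rw [← ENNReal.ofReal_mul (by positivity), ← Real.exp_add]
          rcases le_total y b with hyb | hyb
          · refine le_add_right (ENNReal.ofReal_le_ofReal (Real.exp_le_exp.2 ?_))
            nlinarith
          · refine le_add_left (ENNReal.ofReal_le_ofReal (Real.exp_le_exp.2 ?_))
            nlinarith
      _ = _ := by
          rw [lintegral_add_right _ measurable_const, lintegral_const_mul _ (by fun_prop),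
            lintegral_const, measure_univ, mul_one]
  have h2 : ENNReal.ofReal (Real.exp (-(n + 1))) ≤ ENNReal.ofReal (Real.exp (b ^ 2)) * J := by
    rw [← tsub_le_iff_right, ← ENNReal.ofReal_sub _ (Real.exp_pos _).le] at h1
    refine le_trans (ENNReal.ofReal_le_ofReal ?_) h1
    have h3 : Real.exp (-n) ≤ Real.exp (-(s * laplaceExponent σ τ (2 * x + τ))) :=
      Real.exp_le_exp.2 (by linarith)
    have h4 : Real.exp (-n) = Real.exp 1 * Real.exp (-(n + 1)) := by
      rw [← Real.exp_add]; congr 1; ring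
    have h5 := Real.add_one_le_exp (1 : ℝ)
    nlinarith [Real.exp_pos (-(n + 1))]
  calc ENNReal.ofReal (Real.exp (-(b ^ 2 + n + 1)))
      = ENNReal.ofReal (Real.exp (-b ^ 2)) * ENNReal.ofReal (Real.exp (-(n + 1))) := by
        rw [← ENNReal.ofReal_mul (by positivity), ← Real.exp_add]; congr 2; ring
    _ ≤ ENNReal.ofReal (Real.exp (-b ^ 2)) * (ENNReal.ofReal (Real.exp (b ^ 2)) * J) := by
        gcongr
    _ = J := by
        rw [← mul_assoc, ← ENNReal.ofReal_mul (by positivity), ← Real.exp_add]; simp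

lemma exp_mul_pow_le_one_div_Gamma {D : ℕ} (hD : 1 ≤ D) :
    Real.exp ((D : ℝ) - 1) * (1 / (D : ℝ)) ^ D ≤ 1 / Real.Gamma D := by
  have hD' : (1 : ℝ) ≤ D := by exact_mod_cast hD
  have hG : 0 < Real.Gamma D := Real.Gamma_pos_of_pos (by linarith)
  have h := Gamma_le_exp_one_mul_rpow hD'
  rw [Real.rpow_natCast] at h
  rw [le_div_iff₀ hG]
  calc _ ≤ Real.exp ((D : ℝ) - 1) * (1 / (D : ℝ)) ^ D *
        (Real.exp 1 * (D : ℝ) ^ D * Real.exp (-D)) := by gcongr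
    _ = (Real.exp ((D : ℝ) - 1) * Real.exp 1 * Real.exp (-D)) * ((1 / (D : ℝ)) * D) ^ D := by
        rw [mul_pow]; ring
    _ = 1 := by
        rw [← Real.exp_add, ← Real.exp_add, one_div_mul_cancel (by linarith), one_pow]
        simp

/-- Elementary bounds on the window `[√(D / 2), √(D / 2) + 1 / √D]`, which lies at the maximum of
`x ^ D * exp (-x ^ 2)`. -/
lemma window_bounds {D x : ℝ} (hD : 16 ≤ D) (hx1 : √(D / 2) ≤ x) (hx2 : x ≤ √(D / 2) + 1 / √D) :
    x ≤ √D ∧ √D / 2 ≤ x ∧ x ^ 2 ≤ D / 2 + 3 := by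
  obtain ⟨r, hr⟩ : ∃ r, r = √D := ⟨_, rfl⟩
  obtain ⟨x₀, hx₀⟩ : ∃ x₀, x₀ = √(D / 2) := ⟨_, rfl⟩
  rw [← hx₀] at hx1 hx2
  rw [← hr] at hx2 ⊢
  have hr2 : r ^ 2 = D := by rw [hr, Real.sq_sqrt (by linarith)]
  have hr4 : 4 ≤ r := by rw [hr]; exact Real.le_sqrt_of_sq_le (by linarith)
  have hx₀2 : x₀ ^ 2 = D / 2 := by rw [hx₀, Real.sq_sqrt (by linarith)]
  have hx₀0 : 0 ≤ x₀ := by rw [hx₀]; positivity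
  have hx₀r : x₀ ≤ 3 / 4 * r := by nlinarith
  have hx₀r' : r / 2 ≤ x₀ := by nlinarith
  have hinv : 1 / r ≤ 1 / 4 := one_div_le_one_div_of_le (by norm_num) hr4
  have hinvr : r * (1 / r) = 1 := by field_simp
  refine ⟨by linarith, by linarith, ?_⟩
  calc x ^ 2 ≤ (x₀ + 1 / r) ^ 2 := by gcongr; linarith
    _ = x₀ ^ 2 + 2 * x₀ * (1 / r) + (1 / r) ^ 2 := by ring
    _ ≤ D / 2 + 2 * (3 / 4 * r) * (1 / r) + (1 / 4) ^ 2 := by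
        rw [hx₀2]; gcongr
    _ = D / 2 + 3 / 2 * (r * (1 / r)) + (1 / 4) ^ 2 := by ring
    _ ≤ D / 2 + 3 := by rw [hinvr]; norm_num; linarith

/-- The integrand of the likelihood on the window `[√(D / 2), √(D / 2) + 1 / √D]`. -/
lemma le_integrand {N D : ℕ} (hN : 1 ≤ N) (hD : 16 ≤ D) (h4 : 4 * N ≤ D) {σ τ s x : ℝ} (h0 : 0 < σ)
    (h1 : σ ≤ 1 / 2) (hτ : 0 < τ) (hτ1 : τ ≤ 1) (hs : 0 < s)
    (hτN : τ * √(D : ℝ) ≤ N)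
    (hsψ : s * ((D : ℝ) ^ σ * Real.log (D / τ)) ≤ N)
    (hx1 : √((D : ℝ) / 2) ≤ x)
    (hx2 : x ≤ √((D : ℝ) / 2) + 1 / √(D : ℝ)) :
    ENNReal.ofReal (Real.exp ((D : ℝ) / 2) * (1 / √(2 * (D : ℝ))) ^ D *
      Real.exp (-(σ * N * Real.log D + 3 * N + 5)) /
        √((D : ℝ) / 2)) ≤
    ∫⁻ y, ENNReal.ofReal (Real.exp (-(x + y) ^ 2) *
      (x ^ ((D : ℝ) - σ * (N : ℝ) - 1) * Real.exp (-(τ * x)) /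
        Real.Gamma ((D : ℝ) - σ * (N : ℝ)))) ∂(tiltedStable σ τ s) := by
  have hDR : (16 : ℝ) ≤ D := by exact_mod_cast hD
  have hNR : (1 : ℝ) ≤ N := by exact_mod_cast hN
  have h4R : 4 * (N : ℝ) ≤ D := by exact_mod_cast h4
  obtain ⟨hxr, hrx, hx2'⟩ := window_bounds hDR hx1 hx2
  obtain ⟨r, hr⟩ : ∃ r, r = √(D : ℝ) := ⟨_, rfl⟩
  obtain ⟨x₀, hx₀⟩ : ∃ x₀, x₀ = √((D : ℝ) / 2) := ⟨_, rfl⟩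
  rw [← hr] at hxr hrx hτN
  rw [← hx₀] at hx1 ⊢
  have hr2 : r ^ 2 = D := by rw [hr, Real.sq_sqrt (by linarith)]
  have hr4 : 4 ≤ r := by rw [hr]; exact Real.le_sqrt_of_sq_le (by linarith)
  have hx₀2 : x₀ ^ 2 = D / 2 := by rw [hx₀, Real.sq_sqrt (by linarith)]
  have hx₀0 : 0 < x₀ := by rw [hx₀]; positivity
  have hx0 : 0 < x := hx₀0.trans_le hx1
  have hrr : 4 * r ≤ D := by rw [← hr2, pow_two]; gcongr
  have hξ : 2 * x + τ ≤ D := by linarith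
  have hxD : x ≤ D := by linarith
  -- the Laplace exponent
  have hψ : s * laplaceExponent σ τ (2 * x + τ) ≤ N := by
    refine le_trans ?_ hsψ
    gcongr
    refine (laplaceExponent_le h0 hτ (by positivity)).trans ?_
    have hlog : 0 ≤ Real.log ((2 * x + τ) / τ) :=
      Real.log_nonneg ((one_le_div hτ).2 (by linarith))
    gcongr
  have hI := le_lintegral_tiltedStable (by linarith) hτ hs hx0 (by linarith) hψ
  have hb : (((N : ℝ) + 1) / (2 * x)) ^ 2 ≤ N := by
    rw [div_pow, div_le_iff₀ (by positivity)]
    calc ((N : ℝ) + 1) ^ 2 ≤ (2 * (N : ℝ)) ^ 2 := by gcongr; linarith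
      _ = (N : ℝ) * (4 * N) := by ring
      _ ≤ N * r ^ 2 := by rw [hr2]; gcongr
      _ ≤ N * (2 * x) ^ 2 := by gcongr; linarith
  have hI' : ENNReal.ofReal (Real.exp (-(2 * N + 1))) ≤
      ∫⁻ y, ENNReal.ofReal (Real.exp (-(2 * x * y + y ^ 2))) ∂(tiltedStable σ τ s) := by
    refine le_trans (ENNReal.ofReal_le_ofReal (Real.exp_le_exp.2 ?_)) hI
    linarith
  set p : ℝ := (D : ℝ) - σ * (N : ℝ) with hp
  have hσN : σ * N ≤ 1 / 2 * N := by gcongr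
  have hσN0 : 0 ≤ σ * N := by positivity
  have hp2 : 2 ≤ p := by linarith
  have hpD : p ≤ D := by linarith
  have hGp : 0 < Real.Gamma p := Real.Gamma_pos_of_pos (by linarith)
  have hΓ : Real.exp ((D : ℝ) - 1) * (1 / (D : ℝ)) ^ D ≤ 1 / Real.Gamma p := by
    refine (exp_mul_pow_le_one_div_Gamma (by omega)).trans ?_
    refine one_div_le_one_div_of_le hGp ?_
    exact Real.Gamma_strictMonoOn_Ici.monotoneOn (mem_Ici.2 hp2) (mem_Ici.2 (by linarith)) hpD
  -- the factors that depend on `x` only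
  have hxp : x₀ ^ D / x₀ * Real.exp (-(σ * N * Real.log D)) ≤ x ^ (p - 1) := by
    have e1 : x ^ (p - 1) = x ^ (D - 1) * x ^ (-(σ * N)) := by
      rw [← Real.rpow_natCast x (D - 1), ← Real.rpow_add hx0, Nat.cast_sub (by omega)]
      congr 1; rw [hp]; push_cast; ring
    have e2 : x₀ ^ D / x₀ = x₀ ^ (D - 1) := by
      rw [div_eq_iff hx₀0.ne', ← pow_succ]; congr 1; omega
    rw [e1, e2]
    gcongr
    calc Real.exp (-(σ * N * Real.log D)) = (D : ℝ) ^ (-(σ * N)) := by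
          rw [Real.rpow_def_of_pos (by linarith)]; congr 1; ring
      _ ≤ x ^ (-(σ * N)) := Real.rpow_le_rpow_of_nonpos hx0 hxD (by linarith)
  have hxx : Real.exp (-(D / 2 + 3)) ≤ Real.exp (-x ^ 2) := by
    exact Real.exp_le_exp.2 (neg_le_neg hx2')
  have hxτ : Real.exp (-(N : ℝ)) ≤ Real.exp (-(τ * x)) := by
    refine Real.exp_le_exp.2 (neg_le_neg (le_trans ?_ hτN))
    gcongr
  have hsq : x₀ * (1 / (D : ℝ)) = 1 / √(2 * (D : ℝ)) := by
    have h5 : √(2 * (D : ℝ)) = 2 * x₀ := by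
      rw [hx₀, show 2 * (D : ℝ) = 2 ^ 2 * (D / 2) by ring, Real.sqrt_mul (by norm_num),
        Real.sqrt_sq (by norm_num)]
    rw [h5, show (D : ℝ) = 2 * x₀ ^ 2 by linarith]
    field_simp
  set A : ℝ := Real.exp (-x ^ 2) * (x ^ (p - 1) * Real.exp (-(τ * x)) / Real.Gamma p) with hA
  have hA0 : 0 ≤ A := by positivity
  have hAle : Real.exp ((D : ℝ) / 2) * (1 / √(2 * (D : ℝ))) ^ D *
      Real.exp (-(σ * N * Real.log D + 3 * N + 5)) / x₀ ≤ A * Real.exp (-(2 * N + 1)) := by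
    have e : Real.exp ((D : ℝ) / 2) * (1 / √(2 * (D : ℝ))) ^ D *
        Real.exp (-(σ * N * Real.log D + 3 * N + 5)) / x₀ =
        Real.exp (-(D / 2 + 3)) * ((x₀ ^ D / x₀ * Real.exp (-(σ * N * Real.log D))) *
          Real.exp (-(N : ℝ)) * (Real.exp ((D : ℝ) - 1) * (1 / (D : ℝ)) ^ D)) *
          Real.exp (-(2 * N + 1)) := by
      rw [← hsq, mul_pow]
      have e2 : Real.exp ((D : ℝ) / 2) * Real.exp (-(σ * N * Real.log D + 3 * N + 5)) =
          Real.exp (-(D / 2 + 3)) * Real.exp (-(σ * N * Real.log D)) * Real.exp (-(N : ℝ)) *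
            Real.exp ((D : ℝ) - 1) * Real.exp (-(2 * N + 1)) := by
        simp only [← Real.exp_add]; congr 1; ring
      linear_combination (x₀ ^ D * (1 / (D : ℝ)) ^ D / x₀) * e2
    rw [e, hA, div_eq_mul_one_div (x ^ (p - 1) * Real.exp (-(τ * x)))]
    gcongr
  calc _ ≤ ENNReal.ofReal (A * Real.exp (-(2 * N + 1))) := ENNReal.ofReal_le_ofReal hAle
    _ = ENNReal.ofReal A * ENNReal.ofReal (Real.exp (-(2 * N + 1))) := ENNReal.ofReal_mul hA0
    _ ≤ ENNReal.ofReal A *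
        ∫⁻ y, ENNReal.ofReal (Real.exp (-(2 * x * y + y ^ 2))) ∂(tiltedStable σ τ s) := by
      gcongr
    _ = _ := by
      rw [← lintegral_const_mul _ (by fun_prop)]
      refine lintegral_congr fun y => ?_
      rw [← ENNReal.ofReal_mul hA0]
      congr 1
      have e3 : Real.exp (-(x + y) ^ 2) = Real.exp (-x ^ 2) * Real.exp (-(2 * x * y + y ^ 2)) := by
        rw [← Real.exp_add]; congr 1; ring
      rw [hA, e3]; ring

/-- For small `σ` and suitable `τ` and `s` the likelihood reaches the baseline up to a factor
`exp (-(5 σ N log D* + β N + 3 N + log D* + 5))`. -/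
lemma baseline_le_likelihood (G : FiniteMultigraph) (hN : 1 ≤ G.numVerts)
    (hD : 16 ≤ G.totalDeg) (h4 : 4 * G.numVerts ≤ G.totalDeg) {σ τ s β : ℝ} (h0 : 0 < σ)
    (h1 : σ ≤ 1 / 2) (hτ : 0 < τ) (hτ1 : τ ≤ 1)
    (hτN : τ * √(G.totalDeg : ℝ) ≤ G.numVerts)
    (hs : (G.numVerts : ℝ) * Real.exp (-β) ≤ s)
    (hsψ : s * ((G.totalDeg : ℝ) ^ σ * Real.log (G.totalDeg / τ)) ≤ G.numVerts) :
    ENNReal.ofReal (G.baseline * Real.exp (-(5 * σ * (G.numVerts * Real.log G.totalDeg) +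
      β * G.numVerts + 3 * G.numVerts + Real.log G.totalDeg + 5))) ≤ likelihood G (σ, τ, s) := by
  have hNR : (1 : ℝ) ≤ G.numVerts := by exact_mod_cast hN
  have hDR : (16 : ℝ) ≤ G.totalDeg := by exact_mod_cast hD
  have hs0 : 0 < s := lt_of_lt_of_le (by positivity) hs
  have hJ : ∀ x ∈ Icc √((G.totalDeg : ℝ) / 2)
      (√((G.totalDeg : ℝ) / 2) + 1 / √(G.totalDeg : ℝ)), _ :=
    fun x hx => le_integrand hN hD h4 h0 h1 hτ hτ1 hs0 hτN hsψ hx.1 hx.2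
  have hdeg := G.le_degFactor h0.le h1
  have hdeg0 := G.degFactor_pos (by linarith : σ < 1)
  have hlog := G.sumLogDeg_le
  simp only [likelihood]
  have hΓ : 0 < ∏ i ∈ G.verts, Real.Gamma (G.deg i) :=
    Finset.prod_pos fun i hi => G.Gamma_deg_pos hi
  set N := G.numVerts with hNdef
  set D := G.totalDeg with hDdef
  set K : ℝ := Real.exp ((D : ℝ) / 2) * (1 / √(2 * (D : ℝ))) ^ D *
      Real.exp (-(σ * N * Real.log D + 3 * N + 5)) / √((D : ℝ) / 2) with hK
  have hK0 : 0 ≤ K := by positivity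
  have hreal : G.baseline * Real.exp (-(5 * σ * (N * Real.log D) + β * N + 3 * N + Real.log D + 5))
      ≤ s ^ N * G.degFactor σ * (K * (1 / √(D : ℝ))) := by
    have h5 : (N : ℝ) ^ N * Real.exp (-(β * N)) ≤ s ^ N := by
      calc _ = ((N : ℝ) * Real.exp (-β)) ^ N := by
            rw [mul_pow, ← Real.exp_nat_mul]; congr 2; ring
        _ ≤ _ := by gcongr
    have h6 : (∏ i ∈ G.verts, Real.Gamma (G.deg i)) * Real.exp (-(4 * σ * (N * Real.log D))) ≤
        G.degFactor σ := by
      refine le_trans ?_ hdeg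
      gcongr
    have h7 : Real.exp (-Real.log D) ≤ 1 / √((D : ℝ) / 2) * (1 / √(D : ℝ)) := by
      rw [Real.exp_neg, Real.exp_log (by linarith), one_div_mul_one_div, ← one_div]
      refine one_div_le_one_div_of_le (by positivity) ?_
      calc _ ≤ √(D : ℝ) * √(D : ℝ) := by gcongr; linarith
        _ = D := Real.mul_self_sqrt (by linarith)
    have e : Real.exp (-(5 * σ * (N * Real.log D) + β * N + 3 * N + Real.log D + 5)) =
        Real.exp (-(β * N)) * Real.exp (-(4 * σ * (N * Real.log D))) *
          Real.exp (-(σ * N * Real.log D + 3 * N + 5)) * Real.exp (-Real.log D) := by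
      simp only [← Real.exp_add]; congr 1; ring
    calc _ = ((N : ℝ) ^ N * Real.exp (-(β * N))) *
          ((∏ i ∈ G.verts, Real.Gamma (G.deg i)) * Real.exp (-(4 * σ * (N * Real.log D)))) *
          (Real.exp ((D : ℝ) / 2) * (1 / √(2 * (D : ℝ))) ^ D *
            Real.exp (-(σ * N * Real.log D + 3 * N + 5)) * Real.exp (-Real.log D)) := by
          rw [e, FiniteMultigraph.baseline]; ring
      _ ≤ s ^ N * G.degFactor σ * (Real.exp ((D : ℝ) / 2) * (1 / √(2 * (D : ℝ))) ^ D *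
            Real.exp (-(σ * N * Real.log D + 3 * N + 5)) *
            (1 / √((D : ℝ) / 2) * (1 / √(D : ℝ)))) := by gcongr
      _ = _ := by rw [hK]; ring
  refine (ENNReal.ofReal_le_ofReal hreal).trans ?_
  rw [ENNReal.ofReal_mul (by positivity), ENNReal.ofReal_mul hK0]
  refine mul_le_mul_right ?_ _
  set I := Icc √((D : ℝ) / 2) (√((D : ℝ) / 2) + 1 / √(D : ℝ)) with hI
  have hsub : I ⊆ Ioi 0 := fun x hx => lt_of_lt_of_le (by positivity) hx.1
  have hvol : volume I = ENNReal.ofReal (1 / √(D : ℝ)) := by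
    rw [hI, Real.volume_Icc]; congr 1; ring
  calc ENNReal.ofReal K * ENNReal.ofReal (1 / √(D : ℝ)) = ∫⁻ _ in I, ENNReal.ofReal K := by
        rw [setLIntegral_const, hvol]
    _ ≤ _ := setLIntegral_mono' measurableSet_Icc hJ
    _ ≤ _ := lintegral_mono_set hsub

end GGPModel

/-! ### The dense regime -/

section Dense

variable {ι : Type*} {F : Filter ι} {N D : ι → ℝ}

lemma tendsto_atTop_of_dense (hN : ∀ᶠ t in F, 1 ≤ N t) (hND : ∀ᶠ t in F, N t ≤ D t)
    (hquad : ∀ c : ℝ, 0 < c → Tendsto (fun t => D t / N t ^ (2 + c)) F (𝓝 0)) :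
    Tendsto D F atTop := by
  have h1 : Tendsto (fun t => (D t / N t ^ ((2 : ℝ) + 1))⁻¹) F atTop := by
    refine tendsto_inv_nhdsGT_zero.comp
      (tendsto_nhdsWithin_iff.2 ⟨hquad 1 one_pos, ?_⟩)
    filter_upwards [hN, hND] with t h1 h2
    have : 0 < N t := by linarith
    have : 0 < D t := by linarith
    exact mem_Ioi.2 (by positivity)
  have h3 : Tendsto (fun t => D t ^ (3 : ℝ)) F atTop := by
    refine tendsto_atTop_mono' F ?_ h1
    filter_upwards [hN, hND] with t h1 h2
    have h0 : 0 < N t := by linarith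
    rw [inv_div, show (2 : ℝ) + 1 = 3 by norm_num]
    calc N t ^ (3 : ℝ) / D t ≤ N t ^ (3 : ℝ) := div_le_self (by positivity) (by linarith)
      _ ≤ _ := by gcongr
  have h4 := (tendsto_rpow_atTop (by norm_num : (0 : ℝ) < 1 / 3)).comp h3
  refine h4.congr' ?_
  filter_upwards [hN, hND] with t h1 h2
  simp only [Function.comp]
  rw [← Real.rpow_mul (by linarith)]
  norm_num

lemma eventually_le_rpow (hD : Tendsto D F atTop) {b : ℝ} (hb : 0 < b) (C : ℝ) :
    ∀ᶠ t in F, C ≤ D t ^ b :=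
  ((tendsto_rpow_atTop hb).comp hD).eventually_ge_atTop C

lemma eventually_log_le_rpow (hD : Tendsto D F atTop) {b : ℝ} (hb : 0 < b) :
    ∀ᶠ t in F, 3 * Real.log (D t) ≤ D t ^ b := by
  have h := (isLittleO_log_rpow_atTop hb).bound (by norm_num : (0 : ℝ) < 1 / 3)
  filter_upwards [hD.eventually h, hD.eventually_ge_atTop 1] with t h1 h2
  rw [Real.norm_of_nonneg (Real.log_nonneg h2),
    Real.norm_of_nonneg (Real.rpow_nonneg (by linarith) _)] at h1
  linarith

/-- The number of vertices is at least of order `D* ^ (1 / 2 - o(1))`. -/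
lemma eventually_rpow_le (hN : ∀ᶠ t in F, 1 ≤ N t) (hND : ∀ᶠ t in F, N t ≤ D t)
    (hquad : ∀ c : ℝ, 0 < c → Tendsto (fun t => D t / N t ^ (2 + c)) F (𝓝 0))
    {θ : ℝ} (h0 : 0 < θ) (h1 : θ < 1) (C : ℝ) :
    ∀ᶠ t in F, C * D t ^ (1 / 2 - θ) ≤ N t := by
  have hD := tendsto_atTop_of_dense hN hND hquad
  have hc : 0 < 2 * θ / (1 - θ) := div_pos (by linarith) (by linarith)
  filter_upwards [hN, hND, (hquad _ hc).eventually (gt_mem_nhds one_pos),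
    eventually_le_rpow hD (half_pos h0) C] with t h2 h3 h4 h5
  have hN0 : 0 < N t := by linarith
  have hD0 : 0 < D t := by linarith
  rw [div_lt_one (by positivity)] at h4
  calc C * D t ^ (1 / 2 - θ) ≤ D t ^ (θ / 2) * D t ^ (1 / 2 - θ) := by gcongr
    _ = D t ^ ((1 - θ) / 2) := by rw [← Real.rpow_add hD0]; congr 1; ring
    _ ≤ (N t ^ (2 + 2 * θ / (1 - θ))) ^ ((1 - θ) / 2) := by gcongr
    _ = N t := by
        have : 1 - θ ≠ 0 := by linarith
        rw [← Real.rpow_mul hN0.le,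
          show (2 + 2 * θ / (1 - θ)) * ((1 - θ) / 2) = 1 by field_simp; ring, Real.rpow_one]

/-- The number of vertices is at most of order `D* ^ (1 / 2 + o(1))`. -/
lemma eventually_le_rpow_of_dense (hN : ∀ᶠ t in F, 1 ≤ N t)
    (hdense : ∀ c : ℝ, 0 < c → Tendsto (fun t => D t / N t ^ (2 - c)) F atTop)
    {θ : ℝ} (h0 : 0 < θ) :
    ∀ᶠ t in F, N t ≤ D t ^ (1 / 2 + θ) := by
  have hc : 0 < 4 * θ / (1 + 2 * θ) := by positivity
  filter_upwards [hN, (hdense _ hc).eventually_ge_atTop 1] with t h2 h4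
  have hN0 : 0 < N t := by linarith
  rw [one_le_div (by positivity)] at h4
  calc N t = (N t ^ (2 - 4 * θ / (1 + 2 * θ))) ^ (1 / 2 + θ) := by
        rw [← Real.rpow_mul hN0.le,
          show (2 - 4 * θ / (1 + 2 * θ)) * (1 / 2 + θ) = 1 by field_simp; ring, Real.rpow_one]
    _ ≤ _ := by gcongr

end Dense

/-! ### A lower bound for the evidence -/

namespace GGPModel

lemma mul_le_evidence (Q : Measure (ℝ × ℝ × ℝ)) (G : FiniteMultigraph) {A : Set (ℝ × ℝ × ℝ)}
    (hA : MeasurableSet A) {K : ℝ≥0∞} (hK : ∀ φ ∈ A, K ≤ likelihood G φ) :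
    K * Q A ≤ evidence Q G :=
  calc K * Q A = ∫⁻ _ in A, K ∂Q := (setLIntegral_const A K).symm
    _ ≤ ∫⁻ φ in A, likelihood G φ ∂Q := setLIntegral_mono' hA hK
    _ ≤ _ := setLIntegral_le_lintegral A _

/-- The prior mass of a short interval of values of `τ`. -/
lemma le_measure_Ioo_of_density {Pτ : Measure ℝ} {pτ : ℝ → ℝ≥0∞}
    (hpτ : Pτ = volume.withDensity pτ) {c₄ : ℝ} (hc₄ : 0 < c₄)
    (hlower : ∀ τ : ℝ, 0 < τ → τ < 1 → ENNReal.ofReal (Real.exp (-(c₄ / τ ^ c₄))) ≤ pτ τ)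
    {T : ℝ} (hT0 : 0 < T) (hT1 : T ≤ 1) :
    ENNReal.ofReal (T / 2 * Real.exp (-(c₄ / (T / 2) ^ c₄))) ≤ Pτ (Ioo (T / 2) T) := by
  rw [hpτ, withDensity_apply _ measurableSet_Ioo]
  calc _ = ∫⁻ _ in Ioo (T / 2) T, ENNReal.ofReal (Real.exp (-(c₄ / (T / 2) ^ c₄))) := by
        rw [setLIntegral_const, Real.volume_Ioo, ← ENNReal.ofReal_mul (Real.exp_pos _).le]
        congr 1; ring
    _ ≤ _ := by
        refine setLIntegral_mono' measurableSet_Ioo fun τ hτ => ?_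
        have hτ0 : 0 < τ := (half_pos hT0).trans hτ.1
        refine le_trans (ENNReal.ofReal_le_ofReal (Real.exp_le_exp.2 (neg_le_neg ?_)))
          (hlower τ hτ0 (hτ.2.trans_le hT1))
        have := hτ.1.le
        gcongr

/-- On the product of `0 < σ < δ`, `T / 2 < τ < T` with `T = D* ^ (-a)`, and `s` close to
`κ √(2 D*) D* ^ (-η)`, the likelihood is close to the baseline. -/
lemma baseline_le_likelihood_of_mem (G : FiniteMultigraph) (hN : 1 ≤ G.numVerts)
    (hD : 16 ≤ G.totalDeg) (h4 : 4 * G.numVerts ≤ G.totalDeg) {η δ a κ T : ℝ}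
    (hη0 : 0 < η) (hδ : δ = η / 4) (hη1 : η ≤ 1) (ha0 : 0 < a) (ha1 : a ≤ 1) (hκ : 0 < κ)
    (hT : T = (G.totalDeg : ℝ) ^ (-a))
    (hTN : (G.totalDeg : ℝ) ^ (1 / 2 - a) ≤ G.numVerts)
    (hNη : (G.numVerts : ℝ) ≤ (G.totalDeg : ℝ) ^ (1 / 2 + η / 2))
    (hκη : 2 / κ ≤ (G.totalDeg : ℝ) ^ (η / 2))
    (hw : 1 / ((G.numVerts : ℝ) * Real.log (G.totalDeg : ℝ) ^ 2) ≤ (G.totalDeg : ℝ) ^ (-η) / 2)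
    (hlog1 : 1 ≤ Real.log (G.totalDeg : ℝ))
    (hlog : 3 * Real.log (G.totalDeg : ℝ) ≤ (G.totalDeg : ℝ) ^ (η / 4))
    (hNκ : 4 * κ * (G.totalDeg : ℝ) ^ (1 / 2 - η / 2) ≤ G.numVerts)
    {σ τ s : ℝ} (hσ : σ ∈ Ioo 0 δ) (hτ : τ ∈ Ioo (T / 2) T)
    (hs : |s / (κ * √(2 * (G.totalDeg : ℝ))) - (G.totalDeg : ℝ) ^ (-η)| ≤
      1 / ((G.numVerts : ℝ) * Real.log (G.totalDeg : ℝ) ^ 2)) :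
    ENNReal.ofReal (G.baseline * Real.exp (-(4 * η * (G.numVerts * Real.log G.totalDeg) +
      3 * G.numVerts + Real.log G.totalDeg + 5))) ≤ likelihood G (σ, τ, s) := by
  have hNR : (1 : ℝ) ≤ G.numVerts := by exact_mod_cast hN
  have hDR : (16 : ℝ) ≤ G.totalDeg := by exact_mod_cast hD
  have hbase := G.baseline_pos hN
  have hmain := @baseline_le_likelihood G hN hD h4 σ τ s (2 * η * Real.log G.totalDeg) hσ.1
  set N := G.numVerts
  set D := G.totalDeg
  have hD0 : (0 : ℝ) < D := by linarith
  have hT0 : 0 < T := by rw [hT]; positivity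
  have hT1 : T ≤ 1 := by
    rw [hT]; exact Real.rpow_le_one_of_one_le_of_nonpos (by linarith) (by linarith)
  have hτ0 : 0 < τ := (half_pos hT0).trans hτ.1
  have hS : 0 < κ * √(2 * (D : ℝ)) := by positivity
  have hsq : √(D : ℝ) = (D : ℝ) ^ (1 / 2 : ℝ) := Real.sqrt_eq_rpow _
  have hsq1 : (D : ℝ) ^ (1 / 2 : ℝ) ≤ √(2 * (D : ℝ)) := by
    rw [← hsq]; exact Real.sqrt_le_sqrt (by linarith)
  have hsq2 : √(2 * (D : ℝ)) ≤ 2 * (D : ℝ) ^ (1 / 2 : ℝ) := by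
    rw [← hsq]
    refine Real.sqrt_le_iff.2 ⟨by positivity, ?_⟩
    rw [mul_pow, Real.sq_sqrt hD0.le]; linarith
  have habs := abs_le.1 (hs.trans hw)
  have hDη : 0 < (D : ℝ) ^ (-η) := by positivity
  have hs1 : κ * √(2 * (D : ℝ)) * ((D : ℝ) ^ (-η) / 2) ≤ s := by
    rw [← le_div_iff₀' hS]; linarith [habs.1]
  have hs2 : s ≤ κ * √(2 * (D : ℝ)) * (2 * (D : ℝ) ^ (-η)) := by
    rw [← div_le_iff₀' hS]; linarith [habs.2]
  have hs0 : 0 < s := lt_of_lt_of_le (by positivity) hs1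
  have c1 : σ ≤ 1 / 2 := by linarith [hσ.2]
  have c3 : τ * √(D : ℝ) ≤ N := by
    refine le_trans ?_ hTN
    calc τ * √(D : ℝ) ≤ T * √(D : ℝ) := by gcongr; exact hτ.2.le
      _ = _ := by rw [hT, hsq, ← Real.rpow_add hD0]; congr 1; ring
  have c4 : (N : ℝ) * Real.exp (-(2 * η * Real.log D)) ≤ s := by
    refine le_trans ?_ hs1
    have e1 : Real.exp (-(2 * η * Real.log D)) = (D : ℝ) ^ (-(2 * η)) := by
      rw [Real.rpow_def_of_pos hD0]; congr 1; ring
    have e2 : 1 ≤ κ / 2 * (D : ℝ) ^ (η / 2) := by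
      rw [div_le_iff₀ hκ] at hκη; linarith
    rw [e1]
    calc (N : ℝ) * (D : ℝ) ^ (-(2 * η)) ≤ (D : ℝ) ^ (1 / 2 + η / 2) * (D : ℝ) ^ (-(2 * η)) := by
          gcongr
      _ = 1 * (D : ℝ) ^ (1 / 2 + η / 2 + -(2 * η)) := by rw [← Real.rpow_add hD0, one_mul]
      _ ≤ κ / 2 * (D : ℝ) ^ (η / 2) * (D : ℝ) ^ (1 / 2 + η / 2 + -(2 * η)) := by gcongr
      _ = κ * (D : ℝ) ^ (1 / 2 : ℝ) * ((D : ℝ) ^ (-η) / 2) := by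
          have e3 : (D : ℝ) ^ (η / 2) * (D : ℝ) ^ (1 / 2 + η / 2 + -(2 * η)) =
              (D : ℝ) ^ (1 / 2 : ℝ) * (D : ℝ) ^ (-η) := by
            rw [← Real.rpow_add hD0, ← Real.rpow_add hD0]; congr 1; ring
          linear_combination κ / 2 * e3
      _ ≤ _ := by gcongr
  have c5 : s * ((D : ℝ) ^ σ * Real.log (D / τ)) ≤ N := by
    refine le_trans ?_ hNκ
    have hl0 : 0 ≤ Real.log (D / τ) := Real.log_nonneg ((one_le_div hτ0).2 (by linarith [hτ.2]))
    have hl : Real.log (D / τ) ≤ (D : ℝ) ^ (η / 4) := by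
      refine le_trans ?_ hlog
      have h5 : Real.log T = -(a * Real.log D) := by rw [hT, Real.log_rpow hD0]; ring
      have h6 : Real.log (T / 2) ≤ Real.log τ := Real.log_le_log (by positivity) hτ.1.le
      rw [Real.log_div hT0.ne' two_ne_zero, h5] at h6
      rw [Real.log_div hD0.ne' hτ0.ne']
      have h7 := Real.log_two_lt_d9
      have h8 : a * Real.log D ≤ 1 * Real.log D := by gcongr
      linarith
    have hσD : (D : ℝ) ^ σ ≤ (D : ℝ) ^ (η / 4) := by
      refine Real.rpow_le_rpow_of_exponent_le (by linarith) ?_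
      rw [← hδ]; exact hσ.2.le
    calc s * ((D : ℝ) ^ σ * Real.log (D / τ))
        ≤ κ * (2 * (D : ℝ) ^ (1 / 2 : ℝ)) * (2 * (D : ℝ) ^ (-η)) *
            ((D : ℝ) ^ (η / 4) * (D : ℝ) ^ (η / 4)) := by
          have : s ≤ κ * (2 * (D : ℝ) ^ (1 / 2 : ℝ)) * (2 * (D : ℝ) ^ (-η)) :=
            hs2.trans (by gcongr)
          gcongr
      _ = 4 * κ * ((D : ℝ) ^ (1 / 2 : ℝ) * (D : ℝ) ^ (-η) *
            ((D : ℝ) ^ (η / 4) * (D : ℝ) ^ (η / 4))) := by ring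
      _ = _ := by
          rw [← Real.rpow_add hD0, ← Real.rpow_add hD0, ← Real.rpow_add hD0]; congr 2; ring
  refine le_trans (ENNReal.ofReal_le_ofReal ?_) (hmain c1 hτ0 (by linarith [hτ.2]) c3 c4 c5)
  gcongr
  have h9 : 0 ≤ (N : ℝ) * Real.log D := by positivity
  have h10 : 5 * σ * (N * Real.log D) ≤ 2 * η * (N * Real.log D) := by
    have : 5 * σ ≤ 2 * η := by linarith [hσ.2]
    gcongr
  linarith

lemma numVerts_pos_of_totalDeg_pos (G : FiniteMultigraph) (h : 0 < G.totalDeg) :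
    1 ≤ G.numVerts := by
  rw [Nat.one_le_iff_ne_zero]
  intro h0
  have : G.verts = ∅ := Finset.card_eq_zero.1 h0
  simp [FiniteMultigraph.totalDeg, this] at h

lemma eventually_one_le_numVerts {G : ℝ≥0 → FiniteMultigraph}
    (hdense : ∀ c : ℝ, 0 < c →
      Tendsto (fun t => ((G t).totalDeg : ℝ) / ((G t).numVerts : ℝ) ^ (2 - c)) atTop atTop) :
    ∀ᶠ t in atTop, 1 ≤ (G t).numVerts := by
  filter_upwards [(hdense 1 one_pos).eventually_gt_atTop 0] with t ht
  refine numVerts_pos_of_totalDeg_pos _ (Nat.pos_of_ne_zero fun h => ?_)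
  simp [h] at ht

/-- The evidence is at least the baseline, up to a factor `exp (-γ N log D*)` with `γ` arbitrarily
small. -/
lemma eventually_baseline_le_evidence {G : ℝ≥0 → FiniteMultigraph}
    (hdense : ∀ c : ℝ, 0 < c →
      Tendsto (fun t => ((G t).totalDeg : ℝ) / ((G t).numVerts : ℝ) ^ (2 - c)) atTop atTop)
    (hquad : ∀ c : ℝ, 0 < c →
      Tendsto (fun t => ((G t).totalDeg : ℝ) / ((G t).numVerts : ℝ) ^ (2 + c)) atTop (𝓝 0))
    {Pσ Pτ Ps : Measure ℝ} [IsProbabilityMeasure Pσ] [IsProbabilityMeasure Pτ]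
    [IsProbabilityMeasure Ps]
    (hσ_mass : ∀ δ : ℝ, 0 < δ → 0 < Pσ (Ioo 0 δ))
    {κ : ℝ} (hκ : 0 < κ) {c₂ c₃ c₄ : ℝ} (hc₂ : 0 < c₂) (hc₃ : 0 < c₃) (hc₄ : 0 < c₄)
    (hs_mass : ∀ᶠ t in atTop, ∀ x : ℝ, ((G t).totalDeg : ℝ) ^ (-c₃) ≤ x → x ≤ 1 →
      ENNReal.ofReal (Real.exp (-(c₂ * ((G t).numVerts : ℝ)))) ≤
        Ps {s : ℝ | |s / (κ * √(2 * ((G t).totalDeg : ℝ))) - x| ≤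
          1 / (((G t).numVerts : ℝ) * Real.log ((G t).totalDeg : ℝ) ^ 2)})
    {pτ : ℝ → ℝ≥0∞} (hpτ : Pτ = volume.withDensity pτ)
    (hpτ_lower : ∀ τ : ℝ, 0 < τ → τ < 1 →
      ENNReal.ofReal (Real.exp (-(c₄ / τ ^ c₄))) ≤ pτ τ)
    {γ : ℝ} (hγ : 0 < γ) :
    ∀ᶠ t in atTop, ENNReal.ofReal ((G t).baseline *
      Real.exp (-(γ * ((G t).numVerts * Real.log (G t).totalDeg)))) ≤
        evidence (Pσ.prod (Pτ.prod Ps)) (G t) := by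
  have hN := eventually_one_le_numVerts hdense
  have hNR : ∀ᶠ t in atTop, (1 : ℝ) ≤ (G t).numVerts := by
    filter_upwards [hN] with t ht; exact_mod_cast ht
  have hND : ∀ᶠ t in atTop, ((G t).numVerts : ℝ) ≤ (G t).totalDeg :=
    Eventually.of_forall fun t => by exact_mod_cast (G t).numVerts_le_totalDeg
  have hDtop := tendsto_atTop_of_dense hNR hND hquad
  -- the exponents
  obtain ⟨η, hη0, hηγ, hηc, hη4⟩ : ∃ η : ℝ, 0 < η ∧ η ≤ γ / 16 ∧ η ≤ c₃ ∧ η ≤ 1 / 4 :=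
    ⟨min (γ / 16) (min c₃ (1 / 4)), by positivity, min_le_left _ _,
      (min_le_right _ _).trans (min_le_left _ _), (min_le_right _ _).trans (min_le_right _ _)⟩
  obtain ⟨a, ha0, hac, ha4⟩ : ∃ a : ℝ, 0 < a ∧ a ≤ 1 / (4 * c₄) ∧ a ≤ 1 / 4 :=
    ⟨min (1 / (4 * c₄)) (1 / 4), by positivity, min_le_left _ _, min_le_right _ _⟩
  have hac' : a * c₄ ≤ 1 / 4 := by
    calc a * c₄ ≤ 1 / (4 * c₄) * c₄ := by gcongr
      _ = 1 / 4 := by field_simp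
  have hm := hσ_mass (η / 4) (by positivity)
  obtain ⟨M, hM⟩ : ∃ M : ℝ, ENNReal.ofReal (Real.exp (-M)) = Pσ (Ioo 0 (η / 4)) := by
    refine ⟨-Real.log (Pσ (Ioo 0 (η / 4))).toReal, ?_⟩
    rw [neg_neg, Real.exp_log (ENNReal.toReal_pos hm.ne' (measure_ne_top _ _)),
      ENNReal.ofReal_toReal (measure_ne_top _ _)]
  have hlogtop := Real.tendsto_log_atTop.comp hDtop
  filter_upwards [hN, hNR, hs_mass,
    hDtop.eventually_ge_atTop 16,
    eventually_le_rpow_of_dense hNR hdense (by norm_num : (0 : ℝ) < 1 / 4),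
    eventually_le_rpow hDtop (by norm_num : (0 : ℝ) < 1 / 4) 4,
    eventually_rpow_le hNR hND hquad ha0 (by linarith) 1,
    eventually_le_rpow_of_dense hNR hdense (half_pos hη0),
    eventually_le_rpow hDtop (half_pos hη0) (2 / κ),
    eventually_rpow_le hNR hND hquad (by norm_num : (0 : ℝ) < 1 / 4) (by norm_num) 2,
    hlogtop.eventually_ge_atTop 1,
    eventually_log_le_rpow hDtop (by positivity : 0 < η / 4),
    eventually_rpow_le hNR hND hquad (half_pos hη0) (by linarith) (4 * κ),
    eventually_rpow_le hNR hND hquad (by norm_num : (0 : ℝ) < 1 / 4) (by norm_num)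
      (c₄ * 2 ^ c₄),
    hlogtop.eventually_ge_atTop ((4 + c₂) * (16 / γ)),
    eventually_rpow_le hNR hND hquad (by norm_num : (0 : ℝ) < 1 / 4) (by norm_num)
      ((8 + |M|) * (16 / γ))]
    with t e1 e2 e3 e4 e5 e6 e7 e8 e9 e10 e11 e12 e13 e14 e15 e16
  simp only [Function.comp] at e11 e15
  rw [one_mul] at e7
  have hbase := (G t).baseline_pos e1
  set N := (G t).numVerts
  set D := (G t).totalDeg
  have hD0 : (0 : ℝ) < D := by linarith
  have hD1 : (1 : ℝ) ≤ D := by linarith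
  have hD16 : 16 ≤ D := by exact_mod_cast e4
  set l := Real.log (D : ℝ) with hl
  have h4N : 4 * N ≤ D := by
    have : (4 : ℝ) * N ≤ D := by
      calc (4 : ℝ) * N ≤ (D : ℝ) ^ (1 / 4 : ℝ) * (D : ℝ) ^ (1 / 2 + 1 / 4 : ℝ) := by gcongr
        _ = D := by rw [← Real.rpow_add hD0]; norm_num
    exact_mod_cast this
  have hw : 1 / ((N : ℝ) * l ^ 2) ≤ (D : ℝ) ^ (-η) / 2 := by
    have h1 : 2 * (D : ℝ) ^ η ≤ N := by
      refine le_trans ?_ e10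
      gcongr
      linarith
    rw [Real.rpow_neg hD0.le, ← one_div, div_div, mul_comm _ (2 : ℝ)]
    refine one_div_le_one_div_of_le (by positivity) (h1.trans ?_)
    exact le_mul_of_one_le_right (by positivity) (one_le_pow₀ e11)
  obtain ⟨T, hT⟩ : ∃ T, T = (D : ℝ) ^ (-a) := ⟨_, rfl⟩
  have hT0 : 0 < T := by rw [hT]; positivity
  have hT1 : T ≤ 1 := by
    rw [hT]; exact Real.rpow_le_one_of_one_le_of_nonpos hD1 (by linarith)
  set S : Set ℝ := {s : ℝ | |s / (κ * √(2 * (D : ℝ))) - (D : ℝ) ^ (-η)| ≤ 1 / ((N : ℝ) * l ^ 2)}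
    with hS
  have hSm : MeasurableSet S := measurableSet_le (by fun_prop) measurable_const
  have hSmass := e3 ((D : ℝ) ^ (-η)) (Real.rpow_le_rpow_of_exponent_le hD1 (by linarith))
    (Real.rpow_le_one_of_one_le_of_nonpos hD1 (by linarith))
  have hτmass := le_measure_Ioo_of_density hpτ hc₄ hpτ_lower hT0 hT1
  have hA := mul_le_evidence (Pσ.prod (Pτ.prod Ps)) (G t)
    (A := Ioo 0 (η / 4) ×ˢ (Ioo (T / 2) T ×ˢ S))
    (measurableSet_Ioo.prod (measurableSet_Ioo.prod hSm))
    (fun φ hφ => baseline_le_likelihood_of_mem (G t) e1 hD16 h4N hη0 rfl (by linarith) ha0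
      (by linarith) hκ hT e7 e8 e9 hw e11 e12 e13 hφ.1 hφ.2.1 hφ.2.2)
  rw [Measure.prod_prod, Measure.prod_prod, ← hM] at hA
  -- the prior mass of the values of `τ`
  have hτmass' : Real.exp (-(l + 1 + N)) ≤ T / 2 * Real.exp (-(c₄ / (T / 2) ^ c₄)) := by
    have h1 : c₄ / (T / 2) ^ c₄ ≤ N := by
      refine le_trans ?_ e14
      rw [Real.div_rpow hT0.le zero_le_two, hT, ← Real.rpow_mul hD0.le, neg_mul,
        Real.rpow_neg hD0.le, div_div_eq_mul_div, div_inv_eq_mul]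
      gcongr
      linarith
    have h2 : Real.exp (-(l + 1)) ≤ T / 2 := by
      have h3 : Real.exp (-l) ≤ T := by
        rw [hT, Real.rpow_def_of_pos hD0]
        refine Real.exp_le_exp.2 ?_
        have : a * l ≤ 1 * l := by gcongr; linarith
        linarith
      have h5 := Real.add_one_le_exp (1 : ℝ)
      rw [neg_add, Real.exp_add, Real.exp_neg 1, ← div_eq_mul_inv]
      gcongr
      linarith
    calc Real.exp (-(l + 1 + N)) = Real.exp (-(l + 1)) * Real.exp (-(N : ℝ)) := by
          rw [← Real.exp_add]; congr 1; ring
      _ ≤ _ := by gcongr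
  refine le_trans ?_ hA
  calc ENNReal.ofReal ((G t).baseline * Real.exp (-(γ * (N * l))))
      ≤ ENNReal.ofReal ((G t).baseline * Real.exp (-(4 * η * (N * l) + 3 * N + l + 5)) *
          (Real.exp (-M) * (Real.exp (-(l + 1 + N)) * Real.exp (-(c₂ * N))))) := by
        refine ENNReal.ofReal_le_ofReal ?_
        rw [mul_assoc]
        gcongr
        rw [← Real.exp_add, ← Real.exp_add, ← Real.exp_add, Real.exp_le_exp]
        have h1 : 4 * η * (N * l) ≤ γ / 4 * (N * l) := by gcongr; linarith
        have h2 : (4 + c₂) * N ≤ γ / 16 * (N * l) := by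
          calc (4 + c₂) * N = γ / 16 * (N * ((4 + c₂) * (16 / γ))) := by field_simp
            _ ≤ _ := by gcongr
        have h3 : (8 + |M|) * l ≤ γ / 16 * (N * l) := by
          have h5 : (8 + |M|) * (16 / γ) ≤ N := by
            refine le_trans ?_ e16
            refine le_mul_of_one_le_right (by positivity) ?_
            exact Real.one_le_rpow hD1 (by norm_num)
          calc (8 + |M|) * l = γ / 16 * ((8 + |M|) * (16 / γ) * l) := by field_simp
            _ ≤ _ := by gcongr
        have h4 : |M| * 1 ≤ |M| * l := by gcongr
        have h5 := le_abs_self M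
        have h6 : 0 ≤ γ * (N * l) := by positivity
        linarith
    _ = ENNReal.ofReal ((G t).baseline * Real.exp (-(4 * η * (N * l) + 3 * N + l + 5))) *
          (ENNReal.ofReal (Real.exp (-M)) * (ENNReal.ofReal (Real.exp (-(l + 1 + N))) *
            ENNReal.ofReal (Real.exp (-(c₂ * N))))) := by
        rw [ENNReal.ofReal_mul (by positivity : 0 ≤ (G t).baseline * _),
          ENNReal.ofReal_mul (Real.exp_pos (-M)).le,
          ENNReal.ofReal_mul (Real.exp_pos (-(l + 1 + N))).le]
    _ ≤ _ := by
        gcongr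
        exact (ENNReal.ofReal_le_ofReal hτmass').trans hτmass

end GGPModel

/-! ### Concentration of the posterior -/

namespace GGPModel

lemma ae_prior {Pσ Pτ Ps : Measure ℝ} [IsProbabilityMeasure Pσ] [IsProbabilityMeasure Pτ]
    [IsProbabilityMeasure Ps] (hσ : Pσ (Ici 1) = 0) (hτ : Pτ (Iic 0) = 0) (hs : Ps (Iic 0) = 0) :
    ∀ᵐ φ ∂(Pσ.prod (Pτ.prod Ps)), φ.1 < 1 ∧ 0 < φ.2.1 ∧ 0 < φ.2.2 := by
  have h1 : ∀ᵐ x ∂Pσ, x < 1 := by rw [ae_iff]; simpa [Ici] using hσ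
  have h2 : ∀ᵐ x ∂Pτ, 0 < x := by rw [ae_iff]; simpa [Iic] using hτ
  have h3 : ∀ᵐ x ∂Ps, 0 < x := by rw [ae_iff]; simpa [Iic] using hs
  have h4 := Measure.quasiMeasurePreserving_snd (μ := Pσ) (ν := Pτ.prod Ps)
  filter_upwards [Measure.quasiMeasurePreserving_fst.ae h1,
    h4.ae (Measure.quasiMeasurePreserving_fst.ae h2),
    h4.ae (Measure.quasiMeasurePreserving_snd.ae h3)] with φ a b c
  exact ⟨a, b, c⟩

lemma evidence_lt_top {Q : Measure (ℝ × ℝ × ℝ)} [IsProbabilityMeasure Q]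
    (hQ : ∀ᵐ φ ∂Q, φ.1 < 1 ∧ 0 < φ.2.1 ∧ 0 < φ.2.2) (G : FiniteMultigraph)
    (hN : 1 ≤ G.numVerts) : evidence Q G < ∞ := by
  refine lt_of_le_of_lt (lintegral_mono_ae (hQ.mono fun φ h =>
    likelihood_le_const G hN h.1 h.2.1 h.2.2)) ?_
  simp

/-- Values of `σ` above `ε` have little weight compared with the baseline. -/
lemma setLIntegral_likelihood_le {Q : Measure (ℝ × ℝ × ℝ)} [IsProbabilityMeasure Q]
    (hQ : ∀ᵐ φ ∂Q, φ.1 < 1 ∧ 0 < φ.2.1 ∧ 0 < φ.2.2) (G : FiniteMultigraph)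
    (hN : 1 ≤ G.numVerts) {ε m : ℝ} (hε : 0 < ε) (hm0 : 0 ≤ m) (hm : m ≤ G.sumLogDeg) :
    ∫⁻ φ in {φ | ε < φ.1}, likelihood G φ ∂Q ≤
      ENNReal.ofReal (G.baseline * Real.exp (-(ε * m))) := by
  have hbase := G.baseline_pos hN
  have hmeas : MeasurableSet {φ : ℝ × ℝ × ℝ | ε < φ.1} :=
    measurableSet_lt measurable_const measurable_fst
  calc _ ≤ ∫⁻ _ in {φ : ℝ × ℝ × ℝ | ε < φ.1},
        ENNReal.ofReal (G.baseline * Real.exp (-(ε * m))) ∂Q := by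
        refine lintegral_mono_ae ?_
        filter_upwards [ae_restrict_mem hmeas, ae_restrict_of_ae hQ] with φ h1 h2
        have h1 : ε < φ.1 := h1
        refine (likelihood_le_baseline G hN (hε.trans h1) h2.1 h2.2.1 h2.2.2).trans
          (ENNReal.ofReal_le_ofReal ?_)
        have h0 : 0 ≤ φ.1 := (hε.trans h1).le
        gcongr
    _ ≤ _ := by
        rw [setLIntegral_const]
        exact mul_le_of_le_one_right' prob_le_one

end GGPModel

theorem theorem4
    -- the observed multigraphs, indexed by the size parameter
    (G : ℝ≥0 → FiniteMultigraph)
    -- the dense regime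
    (hdense : ∀ c : ℝ, 0 < c →
      Tendsto (fun t => ((G t).totalDeg : ℝ) / ((G t).numVerts : ℝ) ^ (2 - c)) atTop atTop)
    (hquad : ∀ c : ℝ, 0 < c →
      Tendsto (fun t => ((G t).totalDeg : ℝ) / ((G t).numVerts : ℝ) ^ (2 + c)) atTop (𝓝 0))
    (c₁ : ℝ) (hc₁ : 0 < c₁)
    (hlog : ∀ᶠ t in atTop,
      c₁ ≤ (G t).sumLogDeg / (((G t).numVerts : ℝ) * Real.log ((G t).totalDeg : ℝ)))
    -- independent proper priors on `σ`, `τ`, `s`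
    (Pσ Pτ Ps : Measure ℝ) [IsProbabilityMeasure Pσ] [IsProbabilityMeasure Pτ]
    [IsProbabilityMeasure Ps]
    (hσ : Pσ (Ici 1) = 0) (hτ : Pτ (Iic 0) = 0) (hs : Ps (Iic 0) = 0)
    -- the prior of `σ` charges every interval `(0, δ)`
    (hσ_mass : ∀ δ : ℝ, 0 < δ → 0 < Pσ (Ioo 0 δ))
    -- the prior of `s`, on the scale `κ * √(2 D*)`
    (κ : ℝ) (hκ : 0 < κ)
    (c₂ c₃ c₄ : ℝ) (hc₂ : 0 < c₂) (hc₃ : 0 < c₃) (hc₄ : 0 < c₄)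
    (hs_mass : ∀ᶠ t in atTop, ∀ x : ℝ, ((G t).totalDeg : ℝ) ^ (-c₃) ≤ x → x ≤ 1 →
      ENNReal.ofReal (Real.exp (-(c₂ * ((G t).numVerts : ℝ)))) ≤
        Ps {s : ℝ | |s / (κ * √(2 * ((G t).totalDeg : ℝ))) - x| ≤
          1 / (((G t).numVerts : ℝ) * Real.log ((G t).totalDeg : ℝ) ^ 2)})
    -- the prior density of `τ`
    (pτ : ℝ → ℝ≥0∞) (hpτ_meas : Measurable pτ) (hpτ : Pτ = volume.withDensity pτ)
    (hpτ_lower : ∀ τ : ℝ, 0 < τ → τ < 1 →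
      ENNReal.ofReal (Real.exp (-(c₄ / τ ^ c₄))) ≤ pτ τ) :
    -- the posterior is well defined, and concentrates on nonpositive values of `σ`
    (∀ᶠ t in atTop, 0 < GGPModel.evidence (Pσ.prod (Pτ.prod Ps)) (G t) ∧
      GGPModel.evidence (Pσ.prod (Pτ.prod Ps)) (G t) < ∞) ∧
    ∀ ε : ℝ, 0 < ε →
      Tendsto (fun t => GGPModel.posterior (Pσ.prod (Pτ.prod Ps)) (G t) {φ | ε < φ.1})
        atTop (𝓝 0) := by
  have hQ := GGPModel.ae_prior hσ hτ hs
  have hN := GGPModel.eventually_one_le_numVerts hdense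
  have hNR : ∀ᶠ t in atTop, (1 : ℝ) ≤ (G t).numVerts := by
    filter_upwards [hN] with t ht; exact_mod_cast ht
  have hDtop := tendsto_atTop_of_dense hNR
    (Eventually.of_forall fun t => by exact_mod_cast (G t).numVerts_le_totalDeg) hquad
  have hlogtop := Real.tendsto_log_atTop.comp hDtop
  have hlow : ∀ γ : ℝ, 0 < γ → _ := fun γ hγ =>
    GGPModel.eventually_baseline_le_evidence hdense hquad hσ_mass hκ hc₂ hc₃ hc₄ hs_mass hpτ
      hpτ_lower hγ
  refine ⟨?_, fun ε hε => ?_⟩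
  · filter_upwards [hN, hlow 1 one_pos] with t h1 h2
    have hbase := (G t).baseline_pos h1
    exact ⟨lt_of_lt_of_le (ENNReal.ofReal_pos.2 (by positivity)) h2,
      GGPModel.evidence_lt_top hQ (G t) h1⟩
  -- the factor `exp (-ε c₁ N log D*)` gained for `σ > ε` beats the loss in the evidence, which may
  -- be taken to be its square root
  have hbound : ∀ᶠ t in atTop,
      GGPModel.posterior (Pσ.prod (Pτ.prod Ps)) (G t) {φ | ε < φ.1} ≤
        ENNReal.ofReal (Real.exp (-(ε * c₁ / 2 * Real.log (G t).totalDeg))) := by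
    filter_upwards [hN, hNR, hlog, hlow (ε * c₁ / 2) (by positivity),
      hlogtop.eventually_ge_atTop 1] with t h1 h2 h3 h4 h5
    have hl : 1 ≤ Real.log (G t).totalDeg := h5
    have hbase := (G t).baseline_pos h1
    rw [le_div_iff₀ (by positivity)] at h3
    have hup := GGPModel.setLIntegral_likelihood_le hQ (G t) h1 hε (by positivity) h3
    set m := ((G t).numVerts : ℝ) * Real.log (G t).totalDeg with hm
    have hlm : Real.log (G t).totalDeg ≤ m := le_mul_of_one_le_left (by linarith) h2
    calc _ ≤ ENNReal.ofReal ((G t).baseline * Real.exp (-(ε * (c₁ * m)))) /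
          ENNReal.ofReal ((G t).baseline * Real.exp (-(ε * c₁ / 2 * m))) :=
          ENNReal.div_le_div hup h4
      _ = ENNReal.ofReal (Real.exp (-(ε * c₁ / 2 * m))) := by
          rw [← ENNReal.ofReal_div_of_pos (by positivity), mul_div_mul_left _ _ hbase.ne',
            ← Real.exp_sub]
          congr 2; ring
      _ ≤ _ := by gcongr
  refine tendsto_of_tendsto_of_tendsto_of_le_of_le' tendsto_const_nhds ?_
    (Eventually.of_forall fun _ => zero_le) hbound
  rw [← ENNReal.ofReal_zero]
  refine ENNReal.tendsto_ofReal (Real.tendsto_exp_neg_atTop_nhds_zero.comp ?_)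
  exact hlogtop.const_mul_atTop (by positivity)
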